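/- Let $n\ge 1$ and let $S_n$ be the symmetric group. Write a permutation $w\in S_n$ as $w=w_1\cdots w_n$ and put $w_0=0$. The peak set of $w$ is $\{i\in\{1,\dots,n-1\} : w_{i-1}<w_i>w_{i+1}\}$, and its interior peak set is $\{i\in\{2,\dots,n-1\} : w_{i-1}<w_i>w_{i+1}\}$. Let the peak algebra $\mathfrak P_n\subseteq\mathbb{Q}S_n$ be the linear span of the elements $P_F=\sum_{\mathrm{Peak}(w)=F}w$, where $F$ runs over the subsets of $\{1,\dots,n-1\}$ that contain no two consecutive integers. Let $p_j$ be the sum in $\mathbb{Q}S_n$ of all permutations with exactly $j$ peaks, and $\mathring p_j$ (for $j\ge1$) the sum of all permutations with exactly $j-1$ interior peaks (an empty sum is $0$; so $p_1=0$ if $n=1$). Put $$\wp_n=\mathrm{Span}_{\mathbb Q}\{p_j : 0\le j\le\lfloor n/2\rfloor\},\qquad \mathring\wp_n=\mathrm{Span}_{\mathbb Q}\{\mathring p_j : 1\le j\le\lfloor (n+1)/2\rfloor\},\qquad \widehat\wp_n=\wp_n+\mathring\wp_n .$$ Theorem. $\widehat\wp_n$ is a commutative semisimple (unital) subalgebra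 of $\mathbb{Q}S_n$ contained in $\mathfrak P_n$. Moreover: (a) $\widehat\wp_n$ is generated as an algebra by $p_1$ and $\mathring p_1$; (b) $\wp_n$ is the subalgebra of $\widehat\wp_n$ generated by $p_1$, and it is also semisimple; (c) $\mathring\wp_n$ is the two-sided ideal of $\widehat\wp_n$ generated by $\mathring p_1$; (d) $\dim\widehat\wp_n=n$, $\dim\wp_n=\lfloor n/2\rfloor+1$, $\dim\mathring\wp_n=\lfloor (n+1)/2\rfloor$. -/

import Mathlib

/-- The rational group algebra `ℚ S_n`; the product of permutations is composition,
`(u * v) i = u (v i)`. -/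
abbrev PermAlg (n : ℕ) : Type := MonoidAlgebra ℚ (Equiv.Perm (Fin n))

/-- The `i`-th letter `w_i ∈ {1, …, n}` of the word `w_1 … w_n` of a permutation, for
`1 ≤ i ≤ n`. By convention `w_0 = 0` (positions beyond `n` also get `0`; they are never used). -/
def letter {n : ℕ} (w : Equiv.Perm (Fin n)) (i : ℕ) : ℕ :=
  if h : 1 ≤ i ∧ i ≤ n then (w ⟨i - 1, by omega⟩ : ℕ) + 1 else 0

/-- The set of peaks `{i ∈ [n-1] | w_{i-1} < w_i > w_{i+1}}`, where `w_0 = 0`. -/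
def peakSet {n : ℕ} (w : Equiv.Perm (Fin n)) : Finset ℕ :=
  (Finset.Icc 1 (n - 1)).filter
    fun i => letter w (i - 1) < letter w i ∧ letter w (i + 1) < letter w i

/-- The set of interior peaks `{i ∈ {2, …, n-1} | w_{i-1} < w_i > w_{i+1}}`. -/
def intPeakSet {n : ℕ} (w : Equiv.Perm (Fin n)) : Finset ℕ :=
  (Finset.Icc 2 (n - 1)).filter
    fun i => letter w (i - 1) < letter w i ∧ letter w (i + 1) < letter w i

/-- The subsets of `[n-1]` without two consecutive elements. -/
def sparseSets (n : ℕ) : Set (Finset ℕ) :=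
  {F | F ⊆ Finset.Icc 1 (n - 1) ∧ ∀ i ∈ F, i + 1 ∉ F}

noncomputable section

/-- `P_F`, the sum of the permutations with peak set `F`. -/
def peakSum (n : ℕ) (F : Finset ℕ) : PermAlg n :=
  ∑ w : Equiv.Perm (Fin n) with peakSet w = F, MonoidAlgebra.of ℚ (Equiv.Perm (Fin n)) w

/-- The peak algebra, as a subspace of `ℚ S_n`. -/
def peakAlgebra (n : ℕ) : Submodule ℚ (PermAlg n) :=
  Submodule.span ℚ (peakSum n '' sparseSets n)

/-- `p_j`, the sum of the permutations with exactly `j` peaks. -/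
def peakCountSum (n j : ℕ) : PermAlg n :=
  ∑ w : Equiv.Perm (Fin n) with (peakSet w).card = j, MonoidAlgebra.of ℚ (Equiv.Perm (Fin n)) w

/-- `p°_j` for `j ≥ 1`, the sum of the permutations with exactly `j - 1` interior peaks. -/
def intPeakCountSum (n j : ℕ) : PermAlg n :=
  ∑ w : Equiv.Perm (Fin n) with (intPeakSet w).card + 1 = j,
    MonoidAlgebra.of ℚ (Equiv.Perm (Fin n)) w

/-- `℘_n`, the span of `p_0, …, p_⌊n/2⌋`. -/
def peakCountSpan (n : ℕ) : Submodule ℚ (PermAlg n) :=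
  Submodule.span ℚ (peakCountSum n '' Set.Icc 0 (n / 2))

/-- `℘°_n`, the span of `p°_1, …, p°_⌊(n+1)/2⌋`. -/
def intPeakCountSpan (n : ℕ) : Submodule ℚ (PermAlg n) :=
  Submodule.span ℚ (intPeakCountSum n '' Set.Icc 1 ((n + 1) / 2))

/-- `℘̂_n = ℘_n + ℘°_n`. -/
def fullPeakCountSpan (n : ℕ) : Submodule ℚ (PermAlg n) :=
  peakCountSpan n ⊔ intPeakCountSpan n

end

/-! For x ≥ 1 let Σ_x (`shuffleSum`) be the sum, over all words of length n in x letters, of the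
permutation listing positions by decreasing letter, where equal even letters are read left to right
and equal odd letters right to left. Combining two words in boustrophedon order is a bijection onto
words in xy letters under which the sorting permutations multiply, so Σ_x Σ_y = Σ_{xy}
(`shuffleSum_mul`).

The coefficient of w in Σ_x counts weakly decreasing sequences whose permitted ties are governed by
the descents of w. By `enrichedTotal_generatingFunctions` it depends only on the number of peaks if
x is odd, and only on the number of interior peaks if x is even. The resulting expansions are
triangular with nonzero diagonal, so ℘_n, ℘°_n and ℘̂_n are spanned by the Σ_x with x odd, x even
and x arbitrary. Closure, commutativity and the ideal property become facts about products of
integers.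

On each parity class the coefficients are polynomial in x: Σ_x = ∑ x^i e_i for odd x and ∑ x^i f_i
for even x. Multiplicativity makes the e_i - f_i and f_i orthogonal idempotents
(`component_mul_component`), and their span contains ℘̂_n; hence there are no nilpotents, and
semisimplicity follows. Vandermonde inversion recovers every e_i from the powers Σ_{3^k} of Σ_3, a
combination of 1 and p_1; Σ_2 = 2p°_1 then supplies the even x.

For dimensions, peaks plus interior peaks takes exactly the values 0, …, n-1 and determines both
counts, so its level sums form a basis of ℘̂_n. -/

/-! ### Enriched sequences and their recursions -/

/-- Number of enriched sequences `y = g 0 ≥ g 1 ≥ ⋯ ≥ g m` for the descent word `d`: a repetition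
`g i = g (i + 1)` is allowed on even letters at ascents and on odd letters at descents. -/
def enrichedCount : ℕ → (ℕ → Bool) → ℕ → ℚ
  | 0, _, _ => 1
  | m + 1, d, y => ∑ z ∈ Finset.range y, enrichedCount m (fun i => d (i + 1)) z +
      if (Even y ↔ d 0 = false) then enrichedCount m (fun i => d (i + 1)) y else 0

/-- Number of enriched sequences of length `m + 1` with letters in `{0, …, x - 1}`. -/
def enrichedTotal (m : ℕ) (d : ℕ → Bool) (x : ℕ) : ℚ :=
  ∑ y ∈ Finset.range x, enrichedCount m d y

/-- The number of peaks and the number of interior peaks of a word with descent word `d`. -/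
def peakStats : ℕ → (ℕ → Bool) → ℕ × ℕ
  | 0, _ => (0, 0)
  | m + 1, d =>
      if d 0 then ((peakStats m fun i => d (i + 1)).2 + 1, (peakStats m fun i => d (i + 1)).2)
      else ((peakStats m fun i => d (i + 1)).1, (peakStats m fun i => d (i + 1)).1)

theorem enrichedTotal_succ (m : ℕ) (d : ℕ → Bool) (x : ℕ) :
    enrichedTotal m d (x + 1) = enrichedTotal m d x + enrichedCount m d x :=
  Finset.sum_range_succ _ _

theorem enrichedCount_succ (m : ℕ) (d : ℕ → Bool) (y : ℕ) :
    enrichedCount (m + 1) d y = enrichedTotal m (fun i => d (i + 1)) y +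
      if (Even y ↔ d 0 = false) then enrichedCount m (fun i => d (i + 1)) y else 0 := rfl

/-- The parity of the head decides whether the tail may start with a tie. For either parity of the
head, an ascent leads to a tail total at an odd bound and a descent to one at an even bound; this
separates the two parity classes. -/
theorem enrichedCount_ascent_even {m : ℕ} {d : ℕ → Bool} (h : d 0 = false) (k : ℕ) :
    enrichedCount (m + 1) d (2 * k) = enrichedTotal m (fun i => d (i + 1)) (2 * k + 1) := by
  rw [enrichedCount_succ, enrichedTotal_succ, if_pos (by simp [h])]

theorem enrichedCount_ascent_odd {m : ℕ} {d : ℕ → Bool} (h : d 0 = false) (k : ℕ) :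
    enrichedCount (m + 1) d (2 * k + 1) = enrichedTotal m (fun i => d (i + 1)) (2 * k + 1) := by
  rw [enrichedCount_succ, if_neg (by simp [h, parity_simps]), add_zero]

theorem enrichedCount_descent_even {m : ℕ} {d : ℕ → Bool} (h : d 0 = true) (k : ℕ) :
    enrichedCount (m + 1) d (2 * k) = enrichedTotal m (fun i => d (i + 1)) (2 * k) := by
  rw [enrichedCount_succ, if_neg (by simp [h]), add_zero]

theorem enrichedCount_descent_odd {m : ℕ} {d : ℕ → Bool} (h : d 0 = true) (k : ℕ) :
    enrichedCount (m + 1) d (2 * k + 1) = enrichedTotal m (fun i => d (i + 1)) (2 * k + 2) := by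
  rw [enrichedCount_succ, enrichedTotal_succ _ _ (2 * k + 1),
    if_pos (by simp [h, parity_simps])]

theorem enrichedTotal_ascent_even {m : ℕ} {d : ℕ → Bool} (h : d 0 = false) (k : ℕ) :
    enrichedTotal (m + 1) d (2 * k) =
      2 * ∑ j ∈ Finset.range k, enrichedTotal m (fun i => d (i + 1)) (2 * j + 1) := by
  induction k with
  | zero => simp [enrichedTotal]
  | succ k ih =>
    rw [Finset.sum_range_succ, mul_add, mul_add, ← ih, mul_one, enrichedTotal_succ,
      enrichedTotal_succ, enrichedCount_ascent_even h, enrichedCount_ascent_odd h]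
    ring

theorem enrichedTotal_ascent_odd {m : ℕ} {d : ℕ → Bool} (h : d 0 = false) (k : ℕ) :
    enrichedTotal (m + 1) d (2 * k + 1) =
      2 * ∑ j ∈ Finset.range k, enrichedTotal m (fun i => d (i + 1)) (2 * j + 1) +
        enrichedTotal m (fun i => d (i + 1)) (2 * k + 1) := by
  rw [enrichedTotal_succ, enrichedTotal_ascent_even h, enrichedCount_ascent_even h]

/-- Here the heads 2j + 1 and 2j + 2 pair up; a head 0 has no tail, since a tie at an even letter is
forbidden at a descent. -/
theorem enrichedTotal_descent_odd {m : ℕ} {d : ℕ → Bool} (h : d 0 = true) (k : ℕ) :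
    enrichedTotal (m + 1) d (2 * k + 1) =
      2 * ∑ j ∈ Finset.range k, enrichedTotal m (fun i => d (i + 1)) (2 * j + 2) := by
  induction k with
  | zero => simp [enrichedTotal, enrichedCount_succ, h]
  | succ k ih =>
    have h2 := enrichedCount_descent_even (m := m) h (k + 1)
    rw [mul_add, mul_one] at h2
    rw [Finset.sum_range_succ, mul_add, mul_add, ← ih, mul_one, enrichedTotal_succ,
      enrichedTotal_succ, enrichedCount_descent_odd h, h2]
    ring

theorem enrichedTotal_descent_even {m : ℕ} {d : ℕ → Bool} (h : d 0 = true) (k : ℕ) :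
    enrichedTotal (m + 1) d (2 * k + 2) =
      2 * ∑ j ∈ Finset.range k, enrichedTotal m (fun i => d (i + 1)) (2 * j + 2) +
        enrichedTotal m (fun i => d (i + 1)) (2 * k + 2) := by
  rw [enrichedTotal_succ, enrichedTotal_descent_odd h, enrichedCount_descent_odd h]

/-- Guarantees that the natural-number subtractions in the exponents of 1 + X below are not
truncated. -/
theorem two_mul_peakStats_le (m : ℕ) (d : ℕ → Bool) :
    2 * (peakStats m d).1 ≤ m + 1 ∧ 2 * (peakStats m d).2 ≤ m := by
  induction m generalizing d with
  | zero => simp [peakStats]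
  | succ m ih =>
    have := ih fun i => d (i + 1)
    rw [peakStats]
    split_ifs <;> simp only <;> omega

/-! ### Generating functions over the number of letters -/

section GeneratingFunctions

open PowerSeries

/-- The geometric series `1 / (1 - X)`. -/
noncomputable def geomSeries : PowerSeries ℚ := mk fun _ => 1

theorem geomSeries_mul_one_sub : geomSeries * (1 - X) = 1 := mk_one_mul_one_sub_eq_one ℚ

theorem mk_sum_range_succ (f : ℕ → ℚ) :
    mk (fun k => ∑ j ∈ Finset.range (k + 1), f j) = geomSeries * mk f := by
  ext k
  rw [coeff_mul, Finset.Nat.sum_antidiagonal_eq_sum_range_succ_mk, coeff_mk]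
  rw [← Finset.sum_range_reflect]
  refine Finset.sum_congr rfl fun j hj => ?_
  simp [geomSeries]

theorem mk_sum_range (f : ℕ → ℚ) :
    mk (fun k => ∑ j ∈ Finset.range k, f j) = X * geomSeries * mk f := by
  have h : mk (fun k => ∑ j ∈ Finset.range k, f j) + mk f = geomSeries * mk f := by
    rw [← mk_sum_range_succ]
    ext k
    simp [Finset.sum_range_succ]
  linear_combination h + mk f * geomSeries_mul_one_sub

theorem enrichedTotal_generatingFunctions (m : ℕ) (d : ℕ → Bool) :
    (mk fun k => enrichedTotal m d (2 * k + 1)) =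
        geomSeries ^ (m + 2) * (4 * X) ^ (peakStats m d).1 *
          (1 + X) ^ (m + 1 - 2 * (peakStats m d).1) ∧
      (mk fun k => enrichedTotal m d (2 * k + 2)) =
        2 * geomSeries ^ (m + 2) * (4 * X) ^ (peakStats m d).2 *
          (1 + X) ^ (m - 2 * (peakStats m d).2) := by
  induction m generalizing d with
  | zero =>
    have h : (mk fun k : ℕ => (k : ℚ) + 1) = geomSeries ^ 2 := by
      have := mk_sum_range_succ fun _ => 1
      simp only [Finset.sum_const, Finset.card_range, nsmul_eq_mul, mul_one, Nat.cast_add,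
        Nat.cast_one] at this
      rw [this, pow_two]
      rfl
    have h' : (mk fun k : ℕ => (k : ℚ)) = X * geomSeries ^ 2 := by
      have := mk_sum_range fun _ => 1
      simp only [Finset.sum_const, Finset.card_range, nsmul_eq_mul, mul_one] at this
      rw [this, pow_two, ← mul_assoc]
      rfl
    constructor
    · have : (mk fun k => enrichedTotal 0 d (2 * k + 1)) =
          (mk fun k : ℕ => (k : ℚ) + 1) + mk fun k : ℕ => (k : ℚ) := by
        ext k
        simp [enrichedTotal, enrichedCount]
        ring
      rw [this, h, h']
      simp [peakStats]
      ring
    · have : (mk fun k => enrichedTotal 0 d (2 * k + 2)) =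
          (mk fun k : ℕ => (k : ℚ) + 1) + mk fun k : ℕ => (k : ℚ) + 1 := by
        ext k
        simp [enrichedTotal, enrichedCount]
        ring
      rw [this, h]
      simp [peakStats]
      ring
  | succ m ih =>
    obtain ⟨hO, hE⟩ := ih fun i => d (i + 1)
    obtain ⟨b1, b2⟩ := two_mul_peakStats_le m fun i => d (i + 1)
    cases h : d 0 with
    | false =>
      rw [peakStats, if_neg (by simp [h])]
      generalize (peakStats m fun i => d (i + 1)).1 = p at *
      constructor
      · have : (mk fun k => enrichedTotal (m + 1) d (2 * k + 1)) =
            2 * (mk fun k => ∑ j ∈ Finset.range k,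
              enrichedTotal m (fun i => d (i + 1)) (2 * j + 1)) +
            mk fun k => enrichedTotal m (fun i => d (i + 1)) (2 * k + 1) := by
          ext k
          rw [two_mul]
          simp only [map_add, coeff_mk]
          rw [enrichedTotal_ascent_odd h]
          ring
        -- An ascent keeps the number of peaks: 2X/(1 - X) + 1 = (1 + X)/(1 - X).
        rw [this, mk_sum_range, hO, show m + 1 + 1 - 2 * p = m + 1 - 2 * p + 1 by omega]
        linear_combination (-geomSeries ^ (m + 2) * (4 * X) ^ p * (1 + X) ^ (m + 1 - 2 * p)) *
          geomSeries_mul_one_sub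
      · have : (mk fun k => enrichedTotal (m + 1) d (2 * k + 2)) =
            2 * (mk fun k => ∑ j ∈ Finset.range (k + 1),
              enrichedTotal m (fun i => d (i + 1)) (2 * j + 1)) := by
          ext k
          have := enrichedTotal_ascent_even (m := m) h (k + 1)
          rw [mul_add, mul_one] at this
          rw [two_mul]
          simp only [map_add, coeff_mk]
          rw [this]
          ring
        rw [this, mk_sum_range_succ, hO]
        ring
    | true =>
      rw [peakStats, if_pos h]
      generalize (peakStats m fun i => d (i + 1)).2 = p at *
      constructor
      · have : (mk fun k => enrichedTotal (m + 1) d (2 * k + 1)) =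
            2 * (mk fun k => ∑ j ∈ Finset.range k,
              enrichedTotal m (fun i => d (i + 1)) (2 * j + 2)) := by
          ext k
          rw [two_mul]
          simp only [map_add, coeff_mk]
          rw [enrichedTotal_descent_odd h]
          ring
        -- An initial descent creates a peak: the factor 2X/(1 - X) and the 2 of the even series
        -- give the new 4X.
        rw [this, mk_sum_range, hE, show m + 1 + 1 - 2 * (p + 1) = m - 2 * p by omega]
        ring
      · have : (mk fun k => enrichedTotal (m + 1) d (2 * k + 2)) =
            2 * (mk fun k => ∑ j ∈ Finset.range k,
              enrichedTotal m (fun i => d (i + 1)) (2 * j + 2)) +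
            mk fun k => enrichedTotal m (fun i => d (i + 1)) (2 * k + 2) := by
          ext k
          rw [two_mul]
          simp only [map_add, coeff_mk]
          rw [enrichedTotal_descent_even h]
          ring
        rw [this, mk_sum_range, hE, show m + 1 - 2 * p = m - 2 * p + 1 by omega]
        linear_combination (-2 * geomSeries ^ (m + 2) * (4 * X) ^ p * (1 + X) ^ (m - 2 * p)) *
          geomSeries_mul_one_sub

/-- The number of enriched sequences with `2 k + 1` letters for a word of length `n` with
`p` peaks. -/
noncomputable def oddCoeff (n k p : ℕ) : ℚ :=
  coeff k (geomSeries ^ (n + 1) * (4 * X) ^ p * (1 + X) ^ (n - 2 * p))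

/-- The number of enriched sequences with `2 k + 2` letters for a word of length `n` with
`p` interior peaks. -/
noncomputable def evenCoeff (n k p : ℕ) : ℚ :=
  coeff k (2 * geomSeries ^ (n + 1) * (4 * X) ^ p * (1 + X) ^ (n - 1 - 2 * p))

theorem enrichedTotal_odd (m : ℕ) (d : ℕ → Bool) (k : ℕ) :
    enrichedTotal m d (2 * k + 1) = oddCoeff (m + 1) k (peakStats m d).1 := by
  rw [oddCoeff, ← (enrichedTotal_generatingFunctions m d).1, coeff_mk]

theorem enrichedTotal_even (m : ℕ) (d : ℕ → Bool) (k : ℕ) :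
    enrichedTotal m d (2 * k + 2) = evenCoeff (m + 1) k (peakStats m d).2 := by
  rw [evenCoeff, Nat.add_sub_cancel, ← (enrichedTotal_generatingFunctions m d).2, coeff_mk]

theorem coeff_mul_four_X_pow_mul (f g : PowerSeries ℚ) (k p : ℕ) :
    coeff k (f * (4 * X) ^ p * g) = if p ≤ k then coeff (k - p) (4 ^ p * f * g) else 0 := by
  rw [← coeff_X_pow_mul']
  congr 1
  ring

theorem oddCoeff_of_lt {n k p : ℕ} (h : k < p) : oddCoeff n k p = 0 := by
  rw [oddCoeff, coeff_mul_four_X_pow_mul, if_neg (by omega)]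

theorem evenCoeff_of_lt {n k p : ℕ} (h : k < p) : evenCoeff n k p = 0 := by
  rw [evenCoeff, coeff_mul_four_X_pow_mul, if_neg (by omega)]

theorem constantCoeff_geomSeries : constantCoeff geomSeries = 1 := by
  simp [geomSeries, ← coeff_zero_eq_constantCoeff_apply]

theorem oddCoeff_self (n p : ℕ) : oddCoeff n p p = 4 ^ p := by
  rw [oddCoeff, coeff_mul_four_X_pow_mul, if_pos le_rfl, Nat.sub_self,
    coeff_zero_eq_constantCoeff_apply]
  simp [constantCoeff_geomSeries, map_ofNat]

theorem evenCoeff_self (n p : ℕ) : evenCoeff n p p = 4 ^ p * 2 := by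
  rw [evenCoeff, coeff_mul_four_X_pow_mul, if_pos le_rfl, Nat.sub_self,
    coeff_zero_eq_constantCoeff_apply]
  simp [constantCoeff_geomSeries, map_ofNat]

end GeneratingFunctions

/-! ### Polynomial dependence on the number of letters -/

section Polynomiality

open Polynomial

theorem exists_polynomial_sum_range (P : ℚ[X]) :
    ∃ Q : ℚ[X], ∀ k : ℕ, ∑ j ∈ Finset.range k, P.eval (j : ℚ) = Q.eval (k : ℚ) := by
  induction P using Polynomial.induction_on' with
  | add p q hp hq =>
    obtain ⟨p', hp⟩ := hp
    obtain ⟨q', hq⟩ := hq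
    exact ⟨p' + q', fun k => by simp [Finset.sum_add_distrib, hp, hq]⟩
  | monomial i a =>
    refine ⟨C (a / (i + 1)) * (Polynomial.bernoulli (i + 1) - C (_root_.bernoulli (i + 1))),
      fun k => ?_⟩
    have h := Polynomial.sum_range_pow_eq_bernoulli_sub k i
    have hi : ((i : ℚ) + 1) ≠ 0 := by positivity
    simp only [eval_monomial, eval_mul, eval_C, eval_sub, ← h, Finset.mul_sum]
    refine Finset.sum_congr rfl fun j _ => ?_
    field_simp

theorem enrichedTotal_polynomial (m : ℕ) (d : ℕ → Bool) :
    (∃ P : ℚ[X], ∀ k : ℕ, enrichedTotal m d (2 * k + 1) = P.eval (k : ℚ)) ∧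
      ∃ P : ℚ[X], ∀ k : ℕ, enrichedTotal m d (2 * k + 2) = P.eval (k : ℚ) := by
  induction m generalizing d with
  | zero =>
    exact ⟨⟨2 * X + 1, fun k => by simp [enrichedTotal, enrichedCount]⟩,
      ⟨2 * X + 2, fun k => by simp [enrichedTotal, enrichedCount]⟩⟩
  | succ m ih =>
    obtain ⟨⟨P, hP⟩, ⟨Q, hQ⟩⟩ := ih fun i => d (i + 1)
    obtain ⟨P', hP'⟩ := exists_polynomial_sum_range P
    obtain ⟨Q', hQ'⟩ := exists_polynomial_sum_range Q
    cases h : d 0 with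
    | false =>
      refine ⟨⟨2 * P' + P, fun k => ?_⟩, ⟨2 * P'.comp (X + 1), fun k => ?_⟩⟩
      · simp [enrichedTotal_ascent_odd h, hP, hP']
      · have := enrichedTotal_ascent_even (m := m) h (k + 1)
        rw [mul_add, mul_one] at this
        simp [this, hP, hP']
    | true =>
      refine ⟨⟨2 * Q', fun k => ?_⟩, ⟨2 * Q' + Q, fun k => ?_⟩⟩
      · simp [enrichedTotal_descent_odd h, hQ, hQ']
      · simp [enrichedTotal_descent_even h, hQ, hQ']

/-- The variable becomes the number of letters x = 2k + 1 instead of k, because Σ is multiplicative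
in x. -/
theorem enrichedTotal_polynomial_odd (m : ℕ) (d : ℕ → Bool) :
    ∃ P : ℚ[X], ∀ k : ℕ, enrichedTotal m d (2 * k + 1) = P.eval ((2 * k + 1 : ℕ) : ℚ) := by
  obtain ⟨P, hP⟩ := (enrichedTotal_polynomial m d).1
  refine ⟨P.comp (C (1 / 2) * (X - 1)), fun k => ?_⟩
  rw [hP]
  simp

theorem enrichedTotal_polynomial_even (m : ℕ) (d : ℕ → Bool) :
    ∃ P : ℚ[X], ∀ k : ℕ, enrichedTotal m d (2 * k + 2) = P.eval ((2 * k + 2 : ℕ) : ℚ) := by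
  obtain ⟨P, hP⟩ := (enrichedTotal_polynomial m d).2
  refine ⟨P.comp (C (1 / 2) * (X - 2)), fun k => ?_⟩
  rw [hP]
  simp

end Polynomiality

/-! ### Enriched sequences as functions -/

/-- Descent condition for sequences counted by `enrichedTotal`. -/
def IsEnriched {m x : ℕ} (d : ℕ → Bool) (g : Fin (m + 1) → Fin x) : Prop :=
  ∀ i : Fin m, g i.succ < g i.castSucc ∨
    g i.succ = g i.castSucc ∧ (Even (g i.castSucc : ℕ) ↔ d i = false)

theorem isEnriched_cons {m x : ℕ} (d : ℕ → Bool) (y : Fin x) (h : Fin (m + 1) → Fin x) :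
    IsEnriched d (Fin.cons y h : Fin (m + 1 + 1) → Fin x) ↔
      (h 0 < y ∨ h 0 = y ∧ (Even (y : ℕ) ↔ d 0 = false)) ∧
        IsEnriched (fun i => d (i + 1)) h := by
  rw [IsEnriched, Fin.forall_fin_succ]
  simp [IsEnriched]

open Classical in
theorem card_isEnriched_head {m x : ℕ} (d : ℕ → Bool) (y : Fin x) :
    ((Finset.univ.filter fun g : Fin (m + 1) → Fin x => IsEnriched d g ∧ g 0 = y).card : ℚ) =
      enrichedCount m d y := by
  induction m generalizing d y with
  | zero =>
    have : (Finset.univ.filter fun g : Fin (0 + 1) → Fin x => IsEnriched d g ∧ g 0 = y) =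
        {fun _ => y} := by
      ext g
      simp only [Finset.mem_filter, Finset.mem_univ, true_and, Finset.mem_singleton]
      constructor
      · rintro ⟨-, h⟩
        funext i
        rw [← h, Fin.fin_one_eq_zero i]
      · rintro rfl
        exact ⟨fun i => i.elim0, rfl⟩
    rw [this]
    simp [enrichedCount]
  | succ m ih =>
    have h1 : (Finset.univ.filter
          fun g : Fin (m + 1 + 1) → Fin x => IsEnriched d g ∧ g 0 = y).card =
        (Finset.univ.filter fun h : Fin (m + 1) → Fin x =>
          IsEnriched (fun i => d (i + 1)) h ∧
            (h 0 < y ∨ h 0 = y ∧ (Even (y : ℕ) ↔ d 0 = false))).card := by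
      refine Finset.card_nbij' (fun g => Fin.tail g) (fun h => Fin.cons y h) ?_ ?_ ?_ ?_
      · intro g hg
        simp only [Finset.coe_filter, Finset.mem_univ, true_and, Set.mem_ofPred_eq] at hg ⊢
        obtain ⟨hg, h0⟩ := hg
        rw [← Fin.cons_self_tail g, isEnriched_cons, h0] at hg
        exact hg.symm
      · intro h hh
        simp only [Finset.coe_filter, Finset.mem_univ, true_and, Set.mem_ofPred_eq] at hh ⊢
        exact ⟨(isEnriched_cons d y h).2 hh.symm, rfl⟩
      · intro g hg
        simp only [Finset.coe_filter, Finset.mem_univ, true_and, Set.mem_ofPred_eq] at hg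
        simp [← hg.2]
      · intro h _
        simp
    have h2 : ∀ z : Fin x, ((Finset.univ.filter fun h : Fin (m + 1) → Fin x =>
          IsEnriched (fun i => d (i + 1)) h ∧
            (h 0 < y ∨ h 0 = y ∧ (Even (y : ℕ) ↔ d 0 = false))).filter
              (fun h => h 0 = z)).card =
        if (z < y ∨ z = y ∧ (Even (y : ℕ) ↔ d 0 = false)) then
          (Finset.univ.filter fun h : Fin (m + 1) → Fin x =>
            IsEnriched (fun i => d (i + 1)) h ∧ h 0 = z).card else 0 := by
      intro z
      rw [Finset.filter_filter]
      split_ifs with hz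
      · congr 1
        ext h
        simp only [Finset.mem_filter, Finset.mem_univ, true_and]
        constructor
        · rintro ⟨⟨a, -⟩, c⟩
          exact ⟨a, c⟩
        · rintro ⟨a, rfl⟩
          exact ⟨⟨a, hz⟩, rfl⟩
      · rw [Finset.card_eq_zero, Finset.filter_eq_empty_iff]
        rintro h - ⟨⟨-, b⟩, rfl⟩
        exact hz b
    rw [h1, Finset.card_eq_sum_card_fiberwise (f := fun h => h 0) (t := Finset.univ)
      (fun _ _ => Finset.mem_coe.2 (Finset.mem_univ _))]
    simp only [h2]
    push_cast
    simp only [ih]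
    rw [enrichedCount_succ, enrichedTotal]
    have h3 : ∀ z : Fin x, (if (z < y ∨ z = y ∧ (Even (y : ℕ) ↔ d 0 = false)) then
          enrichedCount m (fun i => d (i + 1)) z else 0) =
        (if z < y then enrichedCount m (fun i => d (i + 1)) z else 0) +
        (if z = y then (if (Even (y : ℕ) ↔ d 0 = false) then
          enrichedCount m (fun i => d (i + 1)) z else 0) else 0) := by
      intro z
      by_cases hz : z = y
      · simp [hz]
      · simp [hz]
    rw [Finset.sum_congr rfl fun z _ => h3 z, Finset.sum_add_distrib,
      Finset.sum_ite_eq' Finset.univ y]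
    congr 1
    · rw [← Finset.sum_filter]
      refine Finset.sum_bij (fun z _ => (z : ℕ)) ?_ ?_ ?_ ?_
      · intro z hz
        simpa using hz
      · intro a _ b _ h
        exact Fin.ext h
      · intro b hb
        refine ⟨⟨b, (Finset.mem_range.1 hb).trans y.2⟩, ?_, rfl⟩
        exact Finset.mem_filter.2 ⟨Finset.mem_univ _, Fin.lt_def.2 (Finset.mem_range.1 hb)⟩
      · intro _ _
        rfl
    · simp

open Classical in
theorem card_isEnriched {m x : ℕ} (d : ℕ → Bool) :
    ((Finset.univ.filter fun g : Fin (m + 1) → Fin x => IsEnriched d g).card : ℚ) =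
      enrichedTotal m d x := by
  rw [Finset.card_eq_sum_card_fiberwise (f := fun h => h 0) (t := Finset.univ)
      (fun _ _ => Finset.mem_coe.2 (Finset.mem_univ _))]
  simp only [Finset.filter_filter]
  push_cast
  simp only [card_isEnriched_head]
  rw [enrichedTotal, Finset.sum_range]

/-! ### Boustrophedon order and sorting permutations -/

/-- The boustrophedon enumeration of pairs `(a, j)` with `j < y`. -/
def snake (y a j : ℕ) : ℕ := a * y + if Even a then j else y - 1 - j

theorem snake_lt {x y a j : ℕ} (ha : a < x) (hj : j < y) : snake y a j < x * y := by
  have h : (a + 1) * y ≤ x * y := Nat.mul_le_mul_right y ha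
  rw [add_mul, one_mul] at h
  rw [snake]
  split_ifs <;> omega

theorem snake_of_even {y a : ℕ} (ha : Even a) (j : ℕ) : snake y a j = a * y + j := by
  rw [snake, if_pos ha]

theorem snake_of_odd {y a j : ℕ} (ha : ¬ Even a) (hj : j < y) :
    snake y a j + j + 1 = (a + 1) * y := by
  rw [snake, if_neg ha, add_mul]
  omega

/-- An odd outer block is traversed backwards, which also flips the parity of the inner block index;
so the reversals of j agree on both sides. -/
theorem snake_assoc {n x a b j : ℕ} (hb : b < x) (hj : j < n) :
    snake n (snake x a b) j = snake (x * n) a (snake n b j) := by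
  by_cases ha : Even a
  · have h : Even (a * x + b) ↔ Even b := by simp [Nat.even_add, ha.mul_right]
    simp only [snake, if_pos ha, h]
    ring
  · have e1 := snake_of_odd ha hb
    have e2 := snake_of_odd ha (snake_lt hb hj)
    have h : Even (snake x a b) ↔ ¬ Even b := by
      have : Even (snake x a b + b + 1) := by
        rw [e1]
        exact Even.mul_right (by simpa [Nat.even_add_one] using ha) x
      rw [Nat.even_add_one, Nat.even_add] at this
      tauto
    have e3 : (snake x a b + b + 1) * n = (a + 1) * x * n := by rw [e1]
    by_cases hbe : Even b
    · have e4 := snake_of_odd (fun h' => h.1 h' hbe) hj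
      have e5 := snake_of_even (y := n) hbe j
      rw [e5] at e2 ⊢
      linarith
    · have e4 := snake_of_even (y := n) (h.2 hbe) j
      have e5 := snake_of_odd hbe hj
      linarith

theorem snake_lt_snake {n a b j k : ℕ} (hj : j < n) (hk : k < n) :
    snake n a j < snake n b k ↔ a < b ∨ a = b ∧ if Even a then j < k else k < j := by
  rcases lt_trichotomy a b with h | rfl | h
  · have h1 : (a + 1) * n ≤ b * n := Nat.mul_le_mul_right n h
    rw [add_mul, one_mul] at h1
    simp only [h, true_or, iff_true]
    rw [snake, snake]
    split_ifs <;> omega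
  · rw [snake, snake]
    split_ifs <;> omega
  · have h1 : (b + 1) * n ≤ a * n := Nat.mul_le_mul_right n h
    rw [add_mul, one_mul] at h1
    simp only [h.not_gt, h.ne', false_and, or_false, iff_false, not_lt]
    rw [snake, snake]
    split_ifs <;> omega

theorem snake_inj {n a b j k : ℕ} (hj : j < n) (hk : k < n) (h : snake n a j = snake n b k) :
    a = b ∧ j = k := by
  have h1 := (snake_lt_snake (a := a) (b := b) hj hk).not.1 h.not_lt
  have h2 := (snake_lt_snake (a := b) (b := a) hk hj).not.1 h.not_gt
  obtain rfl : a = b := by omega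
  simp only [lt_irrefl, true_and, false_or] at h1 h2
  refine ⟨rfl, ?_⟩
  split_ifs at h1 h2 <;> omega

/-- The key by which the positions of the word `f` are sorted. -/
def sortKey {n x : ℕ} (f : Fin n → Fin x) (p : Fin n) : ℕ := snake n (f p) (n - 1 - p)

theorem sortKey_injective {n x : ℕ} (f : Fin n → Fin x) : Function.Injective (sortKey f) := by
  intro p q h
  have := (snake_inj (by omega) (by omega) h).2
  omega

/-- The permutation listing the positions of the word `f` by decreasing key. -/
def sortPerm {n x : ℕ} (f : Fin n → Fin x) : Equiv.Perm (Fin n) :=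
  Tuple.sort fun p => OrderDual.toDual (sortKey f p)

theorem strictAnti_sortKey_comp_sortPerm {n x : ℕ} (f : Fin n → Fin x) :
    StrictAnti fun i => sortKey f (sortPerm f i) := by
  have h := Tuple.monotone_sort fun p => OrderDual.toDual (sortKey f p)
  intro i j hij
  refine lt_of_le_of_ne (h hij.le) fun e => hij.ne' ?_
  exact (sortPerm f).injective (sortKey_injective f e)

theorem sortPerm_eq_iff {n x : ℕ} (f : Fin n → Fin x) (w : Equiv.Perm (Fin n)) :
    sortPerm f = w ↔ StrictAnti fun i => sortKey f (w i) := by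
  constructor
  · rintro rfl
    exact strictAnti_sortKey_comp_sortPerm f
  · intro h
    have := Tuple.unique_monotone (f := fun p => OrderDual.toDual (sortKey f p))
      (σ := sortPerm f) (τ := w) (Tuple.monotone_sort _) (fun i j hij => h.antitone hij)
    refine Equiv.ext fun i => sortKey_injective f ?_
    exact OrderDual.toDual.injective (congrFun this i)

theorem sortKey_lt_of_lt {n x : ℕ} {f : Fin n → Fin x} {p q : Fin n}
    (h : p < q) : sortKey f (sortPerm f q) < sortKey f (sortPerm f p) :=
  strictAnti_sortKey_comp_sortPerm f h

/-- The word whose sorting permutation is `sortPerm f * sortPerm g`. -/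
def composeWords {n x y : ℕ} (f : Fin n → Fin x) (g : Fin n → Fin y) : Fin n → Fin (y * x) :=
  fun p => ⟨snake x (g ((sortPerm f).symm p)) (f p), snake_lt (Fin.is_lt _) (Fin.is_lt _)⟩

theorem sortPerm_composeWords {n x y : ℕ} (f : Fin n → Fin x) (g : Fin n → Fin y) :
    sortPerm (composeWords f g) = sortPerm f * sortPerm g := by
  rw [sortPerm_eq_iff]
  -- By associativity, sorting the composed word compares letters of g first and breaks ties by the
  -- key of f. That key decreases along `sortPerm f`, so it orders the q as n - 1 - q does in the
  -- key of g.
  have key : ∀ q : Fin n, sortKey (composeWords f g) (sortPerm f q) =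
      snake (x * n) (g q) (sortKey f (sortPerm f q)) := by
    intro q
    rw [sortKey, sortKey, ← snake_assoc (Fin.is_lt _) (by omega)]
    simp [composeWords]
  intro i j hij
  simp only [Equiv.Perm.mul_apply, key]
  have h := sortKey_lt_of_lt (f := g) hij
  have hb : ∀ p, sortKey f p < x * n := fun p => snake_lt (Fin.is_lt _) (by omega)
  rw [sortKey, sortKey, snake_lt_snake (by omega) (by omega)] at h
  rw [snake_lt_snake (hb _) (hb _)]
  refine h.imp_right fun ⟨e, h⟩ => ⟨e, ?_⟩
  split_ifs at h ⊢
  · exact sortKey_lt_of_lt (Fin.lt_def.2 (by omega))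
  · exact sortKey_lt_of_lt (Fin.lt_def.2 (by omega))

/-- A composed letter determines its low digit, which is f, and hence `sortPerm f`; its high digit
then gives g. Equal cardinalities do the rest. -/
theorem composeWords_bijective (n x y : ℕ) :
    Function.Bijective
      fun fg : (Fin n → Fin x) × (Fin n → Fin y) => composeWords fg.1 fg.2 := by
  rw [Fintype.bijective_iff_injective_and_card]
  constructor
  · rintro ⟨f, g⟩ ⟨f', g'⟩ h
    have h1 : ∀ p, (g ((sortPerm f).symm p) : ℕ) = g' ((sortPerm f').symm p) ∧
        (f p : ℕ) = f' p := fun p =>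
      snake_inj (Fin.is_lt _) (Fin.is_lt _) (congrArg Fin.val (congrFun h p))
    obtain rfl : f = f' := funext fun p => Fin.ext (h1 p).2
    refine Prod.ext rfl (funext fun q => Fin.ext ?_)
    simpa using (h1 (sortPerm f q)).1
  · simp [mul_pow, mul_comm]

noncomputable section

/-- The sum of the sorting permutations of all words of length `n` in `x` letters. -/
def shuffleSum (n x : ℕ) : PermAlg n :=
  ∑ f : Fin n → Fin x, MonoidAlgebra.of ℚ (Equiv.Perm (Fin n)) (sortPerm f)

theorem shuffleSum_mul (n x y : ℕ) :
    shuffleSum n x * shuffleSum n y = shuffleSum n (x * y) := by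
  rw [mul_comm x y, shuffleSum, shuffleSum, shuffleSum, Finset.sum_mul_sum,
    ← Fintype.sum_prod_type']
  refine Fintype.sum_bijective _ (composeWords_bijective n x y) _ _ fun fg => ?_
  rw [sortPerm_composeWords, map_mul]

theorem shuffleSum_one (n : ℕ) : shuffleSum n 1 = 1 := by
  rw [shuffleSum, Fintype.sum_unique, ← map_one (MonoidAlgebra.of ℚ (Equiv.Perm (Fin n)))]
  congr 1
  rw [sortPerm_eq_iff]
  intro i j hij
  simp only [Equiv.Perm.coe_one, id_eq, sortKey]
  rw [snake_lt_snake (by omega) (by omega)]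
  refine Or.inr ⟨by simp, ?_⟩
  rw [if_pos (by simp)]
  have := Fin.lt_def.1 hij
  omega

end

/-! ### Coefficients of the shuffle sums -/

/-- The descent word of a permutation, starting with position `1` of the word. -/
def descentWord {n : ℕ} (w : Equiv.Perm (Fin n)) (i : ℕ) : Bool :=
  decide (letter w (i + 2) < letter w (i + 1))

theorem letter_succ {n : ℕ} (w : Equiv.Perm (Fin n)) (i : Fin n) :
    letter w (i + 1) = (w i : ℕ) + 1 := by
  rw [letter, dif_pos (by omega)]
  rfl

theorem descentWord_eq {m : ℕ} (w : Equiv.Perm (Fin (m + 1))) (i : Fin m) :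
    descentWord w i = decide (w i.succ < w i.castSucc) := by
  have h1 := letter_succ w i.succ
  have h2 := letter_succ w i.castSucc
  simp only [Fin.val_succ, Fin.val_castSucc] at h1 h2
  rw [descentWord, show (i : ℕ) + 2 = i + 1 + 1 from rfl, h1, h2]
  simp only [Nat.add_lt_add_iff_right, Fin.val_fin_lt]

/-- It suffices to compare neighbouring keys. A tie at an even letter requires increasing positions,
hence an ascent of w; at an odd letter it requires a descent. -/
theorem sortPerm_eq_iff_isEnriched {m x : ℕ} (w : Equiv.Perm (Fin (m + 1)))
    (f : Fin (m + 1) → Fin x) :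
    sortPerm f = w ↔ IsEnriched (descentWord w) fun i => f (w i) := by
  rw [sortPerm_eq_iff, Fin.strictAnti_iff_succ_lt, IsEnriched]
  refine forall_congr' fun i => ?_
  have hne : w i.succ ≠ w i.castSucc := fun h => by
    have := congrArg Fin.val (w.injective h)
    simp at this
  have hne' : (w i.succ : ℕ) ≠ w i.castSucc := fun h => hne (Fin.ext h)
  rw [sortKey, sortKey, snake_lt_snake (by omega) (by omega), descentWord_eq, Fin.lt_def,
    Fin.ext_iff]
  refine or_congr Iff.rfl (and_congr_right fun e => ?_)
  rw [e]
  simp only [decide_eq_false_iff_not, Fin.lt_def]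
  split_ifs with h <;> simp only [h, true_iff, false_iff] <;> omega

noncomputable section

theorem shuffleSum_eq (m x : ℕ) :
    shuffleSum (m + 1) x = ∑ w : Equiv.Perm (Fin (m + 1)),
      enrichedTotal m (descentWord w) x • MonoidAlgebra.of ℚ (Equiv.Perm (Fin (m + 1))) w := by
  classical
  rw [shuffleSum, ← Finset.sum_fiberwise (g := fun f => sortPerm f)]
  refine Finset.sum_congr rfl fun w _ => ?_
  rw [Finset.sum_congr rfl fun f hf => by rw [(Finset.mem_filter.1 hf).2], Finset.sum_const,
    ← card_isEnriched, Nat.cast_smul_eq_nsmul ℚ]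
  congr 1
  refine Finset.card_equiv (Equiv.arrowCongr w.symm (Equiv.refl _)) fun f => ?_
  simp only [Finset.mem_filter, Finset.mem_univ, true_and, sortPerm_eq_iff_isEnriched]
  rfl

end

/-! ### Peaks read off from the descent word -/

/-- Index i of the descent word is position i + 1 of the permutation. The alternative i = 0 encodes
the convention w_0 = 0. -/
theorem peakStats_eq_sum (m : ℕ) (d : ℕ → Bool) :
    (peakStats m d).1 = (∑ i ∈ Finset.range m,
        if (i = 0 ∨ d (i - 1) = false) ∧ d i = true then 1 else 0) ∧
      (peakStats m d).2 = (∑ i ∈ Finset.range m,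
        if (i ≠ 0 ∧ d (i - 1) = false) ∧ d i = true then 1 else 0) := by
  induction m generalizing d with
  | zero => simp [peakStats]
  | succ m ih =>
    obtain ⟨h1, h2⟩ := ih fun i => d (i + 1)
    rw [peakStats, Finset.sum_range_succ', Finset.sum_range_succ']
    cases h : d 0 with
    | true =>
      have : ∀ i, (i ≠ 0 ∧ d (i - 1 + 1) = false) ↔ d i = false := by
        intro i
        cases i <;> simp [h]
      simp [h2, this]
    | false =>
      have : ∀ i, (i = 0 ∨ d (i - 1 + 1) = false) ↔ d i = false := by
        intro i
        cases i <;> simp [h]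
      simp [h1, this]

theorem peakStats_fst_eq_or (m : ℕ) (d : ℕ → Bool) :
    (peakStats m d).1 = (peakStats m d).2 ∨ (peakStats m d).1 = (peakStats m d).2 + 1 := by
  cases m with
  | zero => simp [peakStats]
  | succ m =>
    rw [peakStats]
    split_ifs <;> simp

theorem letter_ne {m : ℕ} (w : Equiv.Perm (Fin (m + 1))) {i : ℕ} (h0 : i ≠ 0) (hi : i ≤ m) :
    letter w i ≠ letter w (i + 1) := by
  rw [letter, letter, dif_pos (by omega), dif_pos (by omega)]
  intro h
  have := congrArg Fin.val (w.injective (Fin.ext (Nat.succ_injective h)))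
  simp only at this
  omega

theorem letter_lt_iff {m : ℕ} (w : Equiv.Perm (Fin (m + 1))) {i : ℕ} (hi : i < m) :
    letter w i < letter w (i + 1) ↔ i = 0 ∨ descentWord w (i - 1) = false := by
  rcases i with _ | i
  · simp [letter]
  · have := letter_ne w (Nat.succ_ne_zero i) hi.le
    simp only [descentWord, Nat.add_sub_cancel, decide_eq_false_iff_not, Nat.succ_ne_zero,
      false_or]
    simp only [Nat.succ_eq_add_one, add_assoc, Nat.reduceAdd] at this ⊢
    omega

theorem card_peakSet {m : ℕ} (w : Equiv.Perm (Fin (m + 1))) :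
    (peakSet w).card = (peakStats m (descentWord w)).1 := by
  rw [(peakStats_eq_sum m _).1, ← Finset.card_filter]
  refine Finset.card_nbij' (fun i => i - 1) (fun i => i + 1) ?_ ?_ ?_ ?_
  · intro i hi
    simp only [peakSet, Finset.coe_filter, Finset.mem_Icc, Set.mem_ofPred_eq,
      Nat.add_sub_cancel] at hi
    obtain ⟨i, rfl⟩ := Nat.exists_eq_add_of_le' hi.1.1
    simp only [Finset.coe_filter, Finset.mem_range, Set.mem_ofPred_eq, Nat.add_sub_cancel]
      at hi ⊢
    rw [letter_lt_iff w (by omega)] at hi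
    exact ⟨by omega, hi.2.1, by simpa [descentWord] using hi.2.2⟩
  · intro i hi
    simp only [peakSet, Finset.coe_filter, Finset.mem_Icc, Set.mem_ofPred_eq,
      Finset.mem_range, Nat.add_sub_cancel] at hi ⊢
    rw [letter_lt_iff w (by omega)]
    exact ⟨by omega, hi.2.1, by simpa [descentWord] using hi.2.2⟩
  · intro i hi
    simp only [peakSet, Finset.coe_filter, Finset.mem_Icc, Set.mem_ofPred_eq] at hi
    exact Nat.sub_add_cancel (by omega)
  · intro i _
    rfl

theorem card_intPeakSet {m : ℕ} (w : Equiv.Perm (Fin (m + 1))) :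
    (intPeakSet w).card = (peakStats m (descentWord w)).2 := by
  rw [(peakStats_eq_sum m _).2, ← Finset.card_filter]
  refine Finset.card_nbij' (fun i => i - 1) (fun i => i + 1) ?_ ?_ ?_ ?_
  · intro i hi
    simp only [intPeakSet, Finset.coe_filter, Finset.mem_Icc, Set.mem_ofPred_eq,
      Nat.add_sub_cancel] at hi
    obtain ⟨i, rfl⟩ := Nat.exists_eq_add_of_le' (Nat.le_of_succ_le hi.1.1)
    simp only [Finset.coe_filter, Finset.mem_range, Set.mem_ofPred_eq, Nat.add_sub_cancel]
      at hi ⊢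
    rw [letter_lt_iff w (by omega)] at hi
    exact ⟨by omega, ⟨by omega, hi.2.1.resolve_left (by omega)⟩,
      by simpa [descentWord] using hi.2.2⟩
  · intro i hi
    simp only [intPeakSet, Finset.coe_filter, Finset.mem_Icc, Set.mem_ofPred_eq,
      Finset.mem_range, Nat.add_sub_cancel] at hi ⊢
    rw [letter_lt_iff w (by omega)]
    exact ⟨by omega, Or.inr hi.2.1.2, by simpa [descentWord] using hi.2.2⟩
  · intro i hi
    simp only [intPeakSet, Finset.coe_filter, Finset.mem_Icc, Set.mem_ofPred_eq] at hi
    exact Nat.sub_add_cancel (by omega)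
  · intro i _
    rfl

theorem intPeakSet_eq_erase {n : ℕ} (w : Equiv.Perm (Fin n)) :
    intPeakSet w = (peakSet w).erase 1 := by
  ext i
  simp only [intPeakSet, peakSet, Finset.mem_filter, Finset.mem_Icc, Finset.mem_erase]
  omega

theorem peakSet_mem_sparseSets {n : ℕ} (w : Equiv.Perm (Fin n)) : peakSet w ∈ sparseSets n := by
  refine ⟨Finset.filter_subset _ _, fun i hi hi' => ?_⟩
  simp only [peakSet, Finset.mem_filter, Nat.add_sub_cancel] at hi hi'
  omega

/-! ### Permutations realizing all peak counts -/

theorem peakStats_of_alternating {m r : ℕ} {d : ℕ → Bool} (hr : r ≤ m)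
    (hd : ∀ i < m, d i = decide (i < r ∧ i % 2 ≠ r % 2)) :
    peakStats m d = ((r + 1) / 2, r / 2) := by
  induction m generalizing r d with
  | zero =>
    obtain rfl : r = 0 := by omega
    rfl
  | succ m ih =>
    have h := ih (r := r - 1) (d := fun i => d (i + 1)) (by omega) fun i hi => by
      rw [hd (i + 1) (by omega), decide_eq_decide]
      omega
    have h0 := hd 0 (by omega)
    rw [peakStats, h, h0]
    by_cases hodd : r % 2 = 1
    · rw [if_pos (by simp; omega)]
      ext <;> simp only <;> omega
    · rw [if_neg (by simp; omega)]
      ext <;> simp only <;> omega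

/-- Exchanges `i` and `i + 1` for all `i < r` with `i ≢ r` modulo `2`. -/
def alternatingSwap (r i : ℕ) : ℕ :=
  if i < r ∧ i % 2 ≠ r % 2 then i + 1 else if 1 ≤ i ∧ i ≤ r ∧ i % 2 = r % 2 then i - 1 else i

theorem alternatingSwap_involutive (r : ℕ) : Function.Involutive (alternatingSwap r) := by
  intro i
  simp only [alternatingSwap]
  split_ifs <;> omega

theorem alternatingSwap_le {r m i : ℕ} (hr : r ≤ m) (hi : i ≤ m) : alternatingSwap r i ≤ m := by
  rw [alternatingSwap]
  split_ifs <;> omega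

theorem alternatingSwap_succ_lt_iff (r i : ℕ) :
    alternatingSwap r (i + 1) < alternatingSwap r i ↔ i < r ∧ i % 2 ≠ r % 2 := by
  simp only [alternatingSwap]
  split_ifs <;> omega

theorem exists_perm_peakStats {m r : ℕ} (hr : r ≤ m) :
    ∃ w : Equiv.Perm (Fin (m + 1)),
      peakStats m (descentWord w) = ((r + 1) / 2, r / 2) := by
  have hinv : Function.Involutive fun i : Fin (m + 1) =>
      (⟨alternatingSwap r i, Nat.lt_succ_of_le (alternatingSwap_le hr (by omega))⟩ :
        Fin (m + 1)) := fun i => Fin.ext (alternatingSwap_involutive r i)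
  refine ⟨hinv.toPerm, peakStats_of_alternating hr fun i hi => ?_⟩
  have := descentWord_eq hinv.toPerm ⟨i, hi⟩
  simp only at this
  rw [this, decide_eq_decide, ← alternatingSwap_succ_lt_iff]
  rfl

/-! ### Linear algebra of polynomial families -/

section Abstract

variable {V R : Type*} [AddCommGroup V] [Module ℚ V] [Ring R] [Algebra ℚ R]

/-- N distinct nodes suffice: the inverse Vandermonde matrix expresses each coefficient through
values in W. -/
theorem mem_of_forall_sum_pow_smul_mem (W : Submodule ℚ V) {N : ℕ} (v : ℕ → V) {t : ℕ → ℚ}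
    (ht : Function.Injective t)
    (h : ∀ k, ∑ i ∈ Finset.range N, t k ^ i • v i ∈ W) {i : ℕ} (hi : i < N) : v i ∈ W := by
  let M := Matrix.vandermonde fun k : Fin N => t k
  have hM : M.det ≠ 0 := Matrix.det_vandermonde_ne_zero_iff.2 fun a b e => Fin.ext (ht e)
  have hinv : M⁻¹ * M = 1 := Matrix.nonsing_inv_mul M (isUnit_iff_ne_zero.2 hM)
  have key : v i = ∑ k : Fin N, M⁻¹ ⟨i, hi⟩ k • ∑ j : Fin N, M k j • v j := by
    simp only [Finset.smul_sum, smul_smul]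
    rw [Finset.sum_comm]
    simp only [← Finset.sum_smul, ← Matrix.mul_apply, hinv, Matrix.one_apply]
    simp
  rw [key]
  refine W.sum_mem fun k _ => W.smul_mem _ ?_
  have := h k
  rw [Finset.sum_range] at this
  simpa [M, Matrix.vandermonde_apply] using this

theorem eq_of_forall_sum_pow_smul_eq {N : ℕ} (v w : ℕ → V) {t : ℕ → ℚ}
    (ht : Function.Injective t)
    (h : ∀ k, ∑ i ∈ Finset.range N, t k ^ i • v i = ∑ i ∈ Finset.range N, t k ^ i • w i)
    {i : ℕ} (hi : i < N) : v i = w i := by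
  have := mem_of_forall_sum_pow_smul_mem (N := N) ⊥ (fun i => v i - w i) ht (fun k => by
    simp [smul_sub, h k]) hi
  simpa [sub_eq_zero] using this

/-- The components of multiplicative polynomial families multiply like orthogonal idempotents. -/
theorem component_mul_component {N : ℕ} {a b : ℕ → R} {e f g : ℕ → R} {s t : ℕ → ℚ}
    (hs : Function.Injective s) (ht : Function.Injective t)
    (ha : ∀ k, a k = ∑ i ∈ Finset.range N, s k ^ i • e i)
    (hb : ∀ k, b k = ∑ i ∈ Finset.range N, t k ^ i • f i)
    (hab : ∀ k l, a k * b l = ∑ i ∈ Finset.range N, (s k * t l) ^ i • g i)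
    {i j : ℕ} (hi : i < N) (hj : j < N) : e i * f j = if i = j then g j else 0 := by
  -- Coefficients are compared first in t l for fixed k, then in s k.
  have h1 : ∀ k, a k * f j = s k ^ j • g j := fun k => by
    refine eq_of_forall_sum_pow_smul_eq (fun j => a k * f j) (fun j => s k ^ j • g j) ht
      (fun l => ?_) hj
    simp only [← mul_smul_comm, ← Finset.mul_sum, ← hb, hab, smul_smul, mul_pow]
    simp only [mul_comm]
  refine eq_of_forall_sum_pow_smul_eq (fun i => e i * f j) (fun i => if i = j then g j else 0)
    hs (fun k => ?_) hi
  simp only [← smul_mul_assoc, ← Finset.sum_mul, ← ha, h1, smul_ite, smul_zero]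
  rw [Finset.sum_ite_eq' _ j, if_pos (Finset.mem_range.2 hj)]

/-- Multiplying a² = 0 by F i leaves c_i² F_i = 0, so each term of a vanishes; the F i themselves
may be zero. -/
theorem eq_zero_of_mul_self_eq_zero_of_mem_span {ι : Type*} [Finite ι] [DecidableEq ι]
    {F : ι → R} (hF : ∀ i j, F i * F j = if i = j then F j else 0) {a : R}
    (ha : a ∈ Submodule.span ℚ (Set.range F)) (h : a * a = 0) : a = 0 := by
  have := Fintype.ofFinite ι
  obtain ⟨c, rfl⟩ := (Submodule.mem_span_range_iff_exists_fun ℚ).1 ha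
  have h1 : ∀ i, F i * ∑ j, c j • F j = c i • F i := by
    intro i
    simp [Finset.mul_sum, hF]
  refine Finset.sum_eq_zero fun i _ => ?_
  have h2 : F i * ((∑ j, c j • F j) * ∑ j, c j • F j) = c i • c i • F i := by
    rw [← mul_assoc, h1, smul_mul_assoc, h1]
  rw [h, mul_zero] at h2
  rcases smul_eq_zero.1 h2.symm with h3 | h3
  · rw [h3, zero_smul]
  · exact h3

theorem Subalgebra.isSemisimpleRing_of_comm_of_reduced [Module.Finite ℚ R] (A : Subalgebra ℚ R)
    (hcomm : ∀ x ∈ A, ∀ y ∈ A, x * y = y * x) (hred : ∀ x ∈ A, x * x = 0 → x = 0) :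
    IsSemisimpleRing A := by
  let _ : CommRing A :=
    { A.toRing with mul_comm := fun x y => Subtype.ext (hcomm x x.2 y y.2) }
  have : Module.Finite ℚ A := inferInstanceAs (Module.Finite ℚ (Subalgebra.toSubmodule A))
  have : IsArtinianRing A := IsArtinianRing.of_finite ℚ A
  have : IsReduced A := (isReduced_iff_pow_one_lt 2 one_lt_two).2 fun x hx =>
    Subtype.ext (hred x x.2 (by simpa [pow_two] using congrArg Subtype.val hx))
  exact IsArtinianRing.isSemisimpleRing_of_isReduced A

theorem mem_span_range_of_triangular {p s : ℕ → V} {c : ℕ → ℕ → ℚ}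
    (h : ∀ k, s k = ∑ j ∈ Finset.range (k + 1), c k j • p j) (hc : ∀ k, c k k ≠ 0) (k : ℕ) :
    p k ∈ Submodule.span ℚ (Set.range s) := by
  induction k using Nat.strong_induction_on with
  | _ k ih =>
    have h1 := h k
    rw [Finset.sum_range_succ] at h1
    have h2 : c k k • p k ∈ Submodule.span ℚ (Set.range s) := by
      rw [← sub_eq_iff_eq_add'.2 h1]
      refine Submodule.sub_mem _ (Submodule.subset_span ⟨k, rfl⟩)
        (Submodule.sum_mem _ fun j hj => Submodule.smul_mem _ _ (ih j (Finset.mem_range.1 hj)))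
    exact (Submodule.smul_mem_iff _ (hc k)).1 h2

theorem mul_mem_span_of_forall_mul_mem {S T U : Set R}
    (h : ∀ x ∈ S, ∀ y ∈ T, x * y ∈ U) {x y : R} (hx : x ∈ Submodule.span ℚ S)
    (hy : y ∈ Submodule.span ℚ T) : x * y ∈ Submodule.span ℚ U := by
  have := Submodule.mul_mem_mul hx hy
  rw [Submodule.span_mul_span] at this
  refine Submodule.span_mono ?_ this
  rintro _ ⟨x, hx, y, hy, rfl⟩
  exact h x hx y hy

theorem mul_comm_of_mem_span {S : Set R} (h : ∀ x ∈ S, ∀ y ∈ S, x * y = y * x) {x y : R}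
    (hx : x ∈ Submodule.span ℚ S) (hy : y ∈ Submodule.span ℚ S) : x * y = y * x := by
  induction hx, hy using Submodule.span_induction₂ with
  | mem_mem x y hx hy => exact h x hx y hy
  | zero_left y => simp
  | zero_right x => simp
  | add_left x y z _ _ _ h1 h2 => rw [add_mul, mul_add, h1, h2]
  | add_right x y z _ _ _ h1 h2 => rw [add_mul, mul_add, h1, h2]
  | smul_left r x y _ _ h => rw [smul_mul_assoc, mul_smul_comm, h]
  | smul_right r x y _ _ h => rw [smul_mul_assoc, mul_smul_comm, h]

end Abstract

/-! ### Sums over level sets of a statistic -/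

section StatSums

variable {G : Type*} [Group G] [Fintype G]

/-- The sum in the group algebra of the elements with value `j` of a statistic. -/
noncomputable def statSum (s : G → ℕ) (j : ℕ) : MonoidAlgebra ℚ G :=
  ∑ w : G with s w = j, MonoidAlgebra.of ℚ G w

theorem coeff_statSum (s : G → ℕ) (j : ℕ) (w : G) :
    (statSum s j).coeff w = if s w = j then 1 else 0 := by
  classical
  change MonoidAlgebra.coeffLinearEquiv ℚ (statSum s j) w = _
  rw [statSum, map_sum, Finset.sum_filter]
  simp only [Finsupp.finsetSum_apply]
  rw [Finset.sum_eq_single w]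
  · split_ifs <;> simp [MonoidAlgebra.coeffLinearEquiv]
  · intro b _ hb
    split_ifs <;> simp [MonoidAlgebra.coeffLinearEquiv, hb]
  · simp

theorem sum_smul_of_eq_sum_statSum (s : G → ℕ) (c : ℕ → ℚ) {N : ℕ}
    (hN : ∀ w, N ≤ s w → c (s w) = 0) :
    ∑ w : G, c (s w) • MonoidAlgebra.of ℚ G w = ∑ j ∈ Finset.range N, c j • statSum s j := by
  simp only [statSum, Finset.smul_sum, Finset.sum_filter, smul_ite, smul_zero]
  rw [Finset.sum_comm]
  refine Finset.sum_congr rfl fun w _ => ?_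
  rw [Finset.sum_ite_eq]
  split_ifs with h
  · rfl
  · rw [hN w (by simpa using h), zero_smul]

theorem finrank_span_statSum (s : G → ℕ) (S : Finset ℕ) (hS : ∀ j ∈ S, ∃ w, s w = j) :
    Module.finrank ℚ (Submodule.span ℚ (statSum s '' (S : Set ℕ))) = S.card := by
  have hli : LinearIndependent ℚ fun j : S => statSum s j := by
    rw [Fintype.linearIndependent_iff]
    intro c hc j
    obtain ⟨w, hw⟩ := hS j j.2
    have h := congrArg (fun x => MonoidAlgebra.coeffLinearEquiv ℚ x w) hc
    simp only [map_sum, map_smul, map_zero, Finsupp.finsetSum_apply, Finsupp.smul_apply,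
      Finsupp.zero_apply] at h
    rw [Finset.sum_eq_single j] at h
    · have h' : c j • (statSum s j).coeff w = 0 := h
      simpa [coeff_statSum, hw] using h'
    · intro b _ hb
      change c b • (statSum s b).coeff w = 0
      rw [coeff_statSum, if_neg (fun e => hb (Subtype.ext (e.symm.trans hw))), smul_zero]
    · simp
  have h := finrank_span_eq_card hli
  rw [Fintype.card_coe] at h
  rw [← h, Set.image_eq_range]
  rfl

end StatSums

/-! ### The peak spans in terms of shuffle sums -/

section PeakSpans

theorem peakCountSum_eq_statSum (n : ℕ) :
    peakCountSum n = statSum fun w : Equiv.Perm (Fin n) => (peakSet w).card := rfl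

theorem intPeakCountSum_eq_statSum (n : ℕ) :
    intPeakCountSum n = statSum fun w : Equiv.Perm (Fin n) => (intPeakSet w).card + 1 := rfl

theorem intPeakCountSum_succ (n j : ℕ) :
    intPeakCountSum n (j + 1) =
      statSum (fun w : Equiv.Perm (Fin n) => (intPeakSet w).card) j := by
  simp [intPeakCountSum, statSum]

theorem shuffleSum_odd (m k : ℕ) : shuffleSum (m + 1) (2 * k + 1) =
    ∑ j ∈ Finset.range (k + 1), oddCoeff (m + 1) k j • peakCountSum (m + 1) j := by
  rw [shuffleSum_eq, peakCountSum_eq_statSum, ← sum_smul_of_eq_sum_statSum]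
  · simp only [enrichedTotal_odd, card_peakSet]
  · exact fun w hw => oddCoeff_of_lt hw

theorem shuffleSum_even (m k : ℕ) : shuffleSum (m + 1) (2 * k + 2) =
    ∑ j ∈ Finset.range (k + 1), evenCoeff (m + 1) k j • intPeakCountSum (m + 1) (j + 1) := by
  simp only [intPeakCountSum_succ]
  rw [shuffleSum_eq, ← sum_smul_of_eq_sum_statSum]
  · simp only [enrichedTotal_even, card_intPeakSet]
  · exact fun w hw => evenCoeff_of_lt hw

theorem statSum_eq_zero {G : Type*} [Group G] [Fintype G] {s : G → ℕ} {j : ℕ}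
    (h : ∀ w, s w ≠ j) : statSum s j = 0 := by
  rw [statSum, Finset.sum_filter]
  exact Finset.sum_eq_zero fun w _ => if_neg (h w)

theorem peakCountSum_mem (m j : ℕ) : peakCountSum (m + 1) j ∈ peakCountSpan (m + 1) := by
  by_cases hj : j ≤ (m + 1) / 2
  · exact Submodule.subset_span ⟨j, ⟨Nat.zero_le _, hj⟩, rfl⟩
  · rw [peakCountSum_eq_statSum, statSum_eq_zero fun w => ?_]
    · exact Submodule.zero_mem _
    · have := two_mul_peakStats_le m (descentWord w)
      rw [card_peakSet]
      omega

theorem intPeakCountSum_mem (m j : ℕ) :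
    intPeakCountSum (m + 1) (j + 1) ∈ intPeakCountSpan (m + 1) := by
  by_cases hj : j + 1 ≤ (m + 1 + 1) / 2
  · exact Submodule.subset_span ⟨j + 1, ⟨by omega, hj⟩, rfl⟩
  · rw [intPeakCountSum_eq_statSum, statSum_eq_zero fun w => ?_]
    · exact Submodule.zero_mem _
    · have := two_mul_peakStats_le m (descentWord w)
      rw [card_intPeakSet]
      omega

theorem peakCountSpan_eq_span_shuffleSum (m : ℕ) : peakCountSpan (m + 1) =
    Submodule.span ℚ (Set.range fun k => shuffleSum (m + 1) (2 * k + 1)) := by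
  apply le_antisymm
  · rw [peakCountSpan, Submodule.span_le]
    rintro _ ⟨j, -, rfl⟩
    refine mem_span_range_of_triangular (fun k => shuffleSum_odd m k) (fun k => ?_) j
    rw [oddCoeff_self]
    positivity
  · rw [Submodule.span_le]
    rintro _ ⟨k, rfl⟩
    simp only [shuffleSum_odd]
    exact Submodule.sum_mem _ fun j _ => Submodule.smul_mem _ _ (peakCountSum_mem m j)

theorem intPeakCountSpan_eq_span_shuffleSum (m : ℕ) : intPeakCountSpan (m + 1) =
    Submodule.span ℚ (Set.range fun k => shuffleSum (m + 1) (2 * k + 2)) := by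
  apply le_antisymm
  · rw [intPeakCountSpan, Submodule.span_le]
    rintro _ ⟨j, ⟨hj, -⟩, rfl⟩
    obtain ⟨j, rfl⟩ := Nat.exists_eq_add_of_le' hj
    refine mem_span_range_of_triangular (p := fun j => intPeakCountSum (m + 1) (j + 1))
      (fun k => shuffleSum_even m k) (fun k => ?_) j
    rw [evenCoeff_self]
    positivity
  · rw [Submodule.span_le]
    rintro _ ⟨k, rfl⟩
    simp only [shuffleSum_even]
    exact Submodule.sum_mem _ fun j _ => Submodule.smul_mem _ _ (intPeakCountSum_mem m j)

theorem fullPeakCountSpan_eq_span_shuffleSum (m : ℕ) : fullPeakCountSpan (m + 1) =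
    Submodule.span ℚ (Set.range fun k => shuffleSum (m + 1) (k + 1)) := by
  rw [fullPeakCountSpan, peakCountSpan_eq_span_shuffleSum, intPeakCountSpan_eq_span_shuffleSum,
    ← Submodule.span_union]
  congr 1
  ext x
  constructor
  · rintro (⟨k, rfl⟩ | ⟨k, rfl⟩)
    · exact ⟨2 * k, rfl⟩
    · exact ⟨2 * k + 1, rfl⟩
  · rintro ⟨k, rfl⟩
    rcases Nat.even_or_odd' k with ⟨l, rfl | rfl⟩
    · exact Or.inl ⟨l, rfl⟩
    · exact Or.inr ⟨l, rfl⟩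

/-- Grouping by peak set gives a sum of some P_F. Interior peak counts qualify too, as the interior
peak set is the peak set without 1. -/
theorem sum_filter_peakSet_mem_peakAlgebra (n : ℕ) (P : Finset ℕ → Prop) [DecidablePred P] :
    ∑ w : Equiv.Perm (Fin n) with P (peakSet w), MonoidAlgebra.of ℚ (Equiv.Perm (Fin n)) w ∈
      peakAlgebra n := by
  rw [← Finset.sum_fiberwise_of_maps_to (g := fun w => peakSet w)
    (t := Finset.univ.image fun w : Equiv.Perm (Fin n) => peakSet w)
    (fun w _ => Finset.mem_image_of_mem _ (Finset.mem_univ w))]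
  refine Submodule.sum_mem _ fun F hF => ?_
  obtain ⟨v, -, rfl⟩ := Finset.mem_image.1 hF
  by_cases hv : P (peakSet v)
  · refine Submodule.subset_span ⟨peakSet v, peakSet_mem_sparseSets v, ?_⟩
    rw [peakSum, Finset.filter_filter]
    refine Finset.sum_congr (Finset.filter_congr fun w _ => ?_) fun _ _ => rfl
    exact ⟨fun h => ⟨h ▸ hv, h⟩, fun h => h.2⟩
  · rw [Finset.filter_filter, Finset.filter_false_of_mem, Finset.sum_empty]
    · exact Submodule.zero_mem _
    · rintro w - ⟨h, e⟩
      exact hv (e ▸ h)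

theorem fullPeakCountSpan_le_peakAlgebra (n : ℕ) : fullPeakCountSpan n ≤ peakAlgebra n := by
  refine sup_le ?_ ?_
  · rw [peakCountSpan, Submodule.span_le]
    rintro _ ⟨j, -, rfl⟩
    exact sum_filter_peakSet_mem_peakAlgebra n fun F => F.card = j
  · rw [intPeakCountSpan, Submodule.span_le]
    rintro _ ⟨j, -, rfl⟩
    simp only [intPeakCountSum, intPeakSet_eq_erase]
    exact sum_filter_peakSet_mem_peakAlgebra n fun F => (F.erase 1).card + 1 = j

end PeakSpans

/-! ### Dimensions -/

section Dimensions

/-- The total number of peaks and interior peaks. -/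
def totalPeaks {n : ℕ} (w : Equiv.Perm (Fin n)) : ℕ := (peakSet w).card + (intPeakSet w).card

/-- The two counts differ by 0 or 1, so they are half of their sum, rounded up and down. -/
theorem card_peakSet_eq_totalPeaks {m : ℕ} (w : Equiv.Perm (Fin (m + 1))) :
    (peakSet w).card = (totalPeaks w + 1) / 2 := by
  have := peakStats_fst_eq_or m (descentWord w)
  rw [totalPeaks, card_peakSet, card_intPeakSet]
  omega

theorem card_intPeakSet_eq_totalPeaks {m : ℕ} (w : Equiv.Perm (Fin (m + 1))) :
    (intPeakSet w).card = totalPeaks w / 2 := by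
  have := peakStats_fst_eq_or m (descentWord w)
  rw [totalPeaks, card_peakSet, card_intPeakSet]
  omega

theorem totalPeaks_le {m : ℕ} (w : Equiv.Perm (Fin (m + 1))) : totalPeaks w ≤ m := by
  have := peakStats_fst_eq_or m (descentWord w)
  have := two_mul_peakStats_le m (descentWord w)
  rw [totalPeaks, card_peakSet, card_intPeakSet]
  omega

theorem exists_totalPeaks_eq {m r : ℕ} (hr : r ≤ m) :
    ∃ w : Equiv.Perm (Fin (m + 1)), totalPeaks w = r := by
  obtain ⟨w, hw⟩ := exists_perm_peakStats hr
  refine ⟨w, ?_⟩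
  rw [totalPeaks, card_peakSet, card_intPeakSet, hw]
  simp only
  omega

theorem statSum_mem_span_totalPeaks {m : ℕ} (g : ℕ → ℕ) (j : ℕ) :
    statSum (fun w : Equiv.Perm (Fin (m + 1)) => g (totalPeaks w)) j ∈
      Submodule.span ℚ (statSum (totalPeaks (n := m + 1)) '' (Finset.range (m + 1) : Set ℕ)) := by
  have h := sum_smul_of_eq_sum_statSum (totalPeaks (n := m + 1))
    (fun r => if g r = j then 1 else 0) (N := m + 1)
    (fun w hw => absurd (totalPeaks_le w) (by omega))
  have h' : statSum (fun w : Equiv.Perm (Fin (m + 1)) => g (totalPeaks w)) j =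
      ∑ w : Equiv.Perm (Fin (m + 1)), (if g (totalPeaks w) = j then (1 : ℚ) else 0) •
        MonoidAlgebra.of ℚ (Equiv.Perm (Fin (m + 1))) w := by
    rw [statSum, Finset.sum_filter]
    simp only [ite_smul, one_smul, zero_smul]
  rw [h', h]
  exact Submodule.sum_mem _ fun r hr =>
    Submodule.smul_mem _ _ (Submodule.subset_span ⟨r, Finset.mem_coe.2 hr, rfl⟩)

/-- Each p_{j+1} and each p°_{j+1} is a sum of two consecutive level sums of `totalPeaks`, and p_0
is the first one; the level sums are thus found successively by subtraction. -/
theorem statSum_totalPeaks_mem (m r : ℕ) :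
    statSum (totalPeaks (n := m + 1)) r ∈ fullPeakCountSpan (m + 1) := by
  induction r with
  | zero =>
    have : statSum (totalPeaks (n := m + 1)) 0 = peakCountSum (m + 1) 0 := by
      rw [peakCountSum_eq_statSum]
      ext w
      simp only [coeff_statSum, card_peakSet_eq_totalPeaks]
      congr 1
      rw [eq_iff_iff]
      omega
    rw [this]
    exact Submodule.mem_sup_left (peakCountSum_mem m 0)
  | succ r ih =>
    rcases Nat.even_or_odd' r with ⟨j, rfl | rfl⟩
    · have : statSum (totalPeaks (n := m + 1)) (2 * j) +
          statSum (totalPeaks (n := m + 1)) (2 * j + 1) = intPeakCountSum (m + 1) (j + 1) := by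
        rw [intPeakCountSum_succ]
        ext w
        simp only [MonoidAlgebra.coeff_add, Finsupp.add_apply, coeff_statSum,
          card_intPeakSet_eq_totalPeaks]
        split_ifs <;> first | omega | simp
      rw [← sub_eq_iff_eq_add'.2 this.symm]
      exact Submodule.sub_mem _ (Submodule.mem_sup_right (intPeakCountSum_mem m j)) ih
    · have : statSum (totalPeaks (n := m + 1)) (2 * j + 1) +
          statSum (totalPeaks (n := m + 1)) (2 * j + 1 + 1) = peakCountSum (m + 1) (j + 1) := by
        rw [peakCountSum_eq_statSum]
        ext w
        simp only [MonoidAlgebra.coeff_add, Finsupp.add_apply, coeff_statSum,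
          card_peakSet_eq_totalPeaks]
        split_ifs <;> first | omega | simp
      rw [← sub_eq_iff_eq_add'.2 this.symm]
      exact Submodule.sub_mem _ (Submodule.mem_sup_left (peakCountSum_mem m (j + 1))) ih

theorem finrank_fullPeakCountSpan (m : ℕ) :
    Module.finrank ℚ (fullPeakCountSpan (m + 1)) = m + 1 := by
  have : fullPeakCountSpan (m + 1) =
      Submodule.span ℚ (statSum (totalPeaks (n := m + 1)) '' (Finset.range (m + 1) : Set ℕ)) := by
    apply le_antisymm
    · refine sup_le ?_ ?_
      · rw [peakCountSpan, Submodule.span_le, peakCountSum_eq_statSum]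
        simp only [card_peakSet_eq_totalPeaks]
        rintro _ ⟨j, -, rfl⟩
        exact statSum_mem_span_totalPeaks (fun r => (r + 1) / 2) j
      · rw [intPeakCountSpan, Submodule.span_le, intPeakCountSum_eq_statSum]
        simp only [card_intPeakSet_eq_totalPeaks]
        rintro _ ⟨j, -, rfl⟩
        exact statSum_mem_span_totalPeaks (fun r => r / 2 + 1) j
    · rw [Submodule.span_le]
      rintro _ ⟨r, -, rfl⟩
      exact statSum_totalPeaks_mem m r
  rw [this, finrank_span_statSum, Finset.card_range]
  exact fun r hr => exists_totalPeaks_eq (Nat.le_of_lt_succ (Finset.mem_range.1 hr))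

theorem finrank_peakCountSpan (m : ℕ) :
    Module.finrank ℚ (peakCountSpan (m + 1)) = (m + 1) / 2 + 1 := by
  rw [peakCountSpan, peakCountSum_eq_statSum, ← Finset.coe_Icc, finrank_span_statSum,
    Nat.card_Icc, Nat.sub_zero]
  intro j hj
  -- For j = 0 the truncated value r = 0 is still right. Taking 2j instead could exceed m.
  obtain ⟨w, hw⟩ := exists_totalPeaks_eq (m := m) (r := 2 * j - 1) (by
    have := Finset.mem_Icc.1 hj
    omega)
  exact ⟨w, by rw [card_peakSet_eq_totalPeaks, hw]; omega⟩

theorem finrank_intPeakCountSpan (m : ℕ) :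
    Module.finrank ℚ (intPeakCountSpan (m + 1)) = (m + 1 + 1) / 2 := by
  rw [intPeakCountSpan, intPeakCountSum_eq_statSum, ← Finset.coe_Icc, finrank_span_statSum,
    Nat.card_Icc, Nat.add_sub_cancel]
  intro j hj
  have hj := Finset.mem_Icc.1 hj
  obtain ⟨w, hw⟩ := exists_totalPeaks_eq (m := m) (r := 2 * (j - 1)) (by omega)
  exact ⟨w, by rw [card_intPeakSet_eq_totalPeaks, hw]; omega⟩

end Dimensions

/-! ### Semisimplicity, generators and the ideal -/

section AlgebraStructure

theorem exists_shuffleSum_components (m : ℕ) : ∃ (N : ℕ) (e f : ℕ → PermAlg (m + 1)),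
    (∀ k, shuffleSum (m + 1) (2 * k + 1) =
        ∑ i ∈ Finset.range N, ((2 * k + 1 : ℕ) : ℚ) ^ i • e i) ∧
      ∀ k, shuffleSum (m + 1) (2 * k + 2) =
        ∑ i ∈ Finset.range N, ((2 * k + 2 : ℕ) : ℚ) ^ i • f i := by
  choose P hP using fun w : Equiv.Perm (Fin (m + 1)) =>
    enrichedTotal_polynomial_odd m (descentWord w)
  choose Q hQ using fun w : Equiv.Perm (Fin (m + 1)) =>
    enrichedTotal_polynomial_even m (descentWord w)
  -- A crude bound exceeding all degrees, so that both parity classes share the same N.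
  let N := ∑ w, ((P w).natDegree + (Q w).natDegree) + 1
  have hN : ∀ w, (P w).natDegree + (Q w).natDegree < N := fun w =>
    Nat.lt_succ_of_le (Finset.single_le_sum
      (f := fun w => (P w).natDegree + (Q w).natDegree) (fun _ _ => Nat.zero_le _)
      (Finset.mem_univ w))
  have key : ∀ (T : Equiv.Perm (Fin (m + 1)) → Polynomial ℚ) (x : ℕ),
      (∀ w, (T w).natDegree < N) → (∀ w, enrichedTotal m (descentWord w) x = (T w).eval (x : ℚ)) →
      shuffleSum (m + 1) x = ∑ i ∈ Finset.range N, (x : ℚ) ^ i •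
        ∑ w, (T w).coeff i • MonoidAlgebra.of ℚ (Equiv.Perm (Fin (m + 1))) w := by
    intro T x hT h
    simp only [Finset.smul_sum]
    rw [shuffleSum_eq, Finset.sum_comm]
    refine Finset.sum_congr rfl fun w _ => ?_
    rw [h, Polynomial.eval_eq_sum_range' (hT w), Finset.sum_smul]
    exact Finset.sum_congr rfl fun i _ => by rw [smul_smul, mul_comm]
  exact ⟨N, _, _,
    fun k => key P _ (fun w => lt_of_le_of_lt (Nat.le_add_right _ _) (hN w)) fun w => hP w k,
    fun k => key Q _ (fun w => lt_of_le_of_lt (Nat.le_add_left _ _) (hN w)) fun w => hQ w k⟩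

theorem eq_zero_of_mul_self_of_mem_fullPeakCountSpan {m : ℕ} {x : PermAlg (m + 1)}
    (hx : x ∈ fullPeakCountSpan (m + 1)) (h : x * x = 0) : x = 0 := by
  obtain ⟨N, e, f, he, hf⟩ := exists_shuffleSum_components m
  have ho : Function.Injective fun k : ℕ => ((2 * k + 1 : ℕ) : ℚ) := fun a b h => by
    have := Nat.cast_injective (R := ℚ) h
    omega
  have hv : Function.Injective fun k : ℕ => ((2 * k + 2 : ℕ) : ℚ) := fun a b h => by
    have := Nat.cast_injective (R := ℚ) h
    omega
  have hee : ∀ i j : Fin N, e i * e j = if i = j then e j else 0 := fun i j => by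
    simpa [Fin.ext_iff] using component_mul_component ho ho he he (g := e) (fun k l => by
      rw [shuffleSum_mul, ← Nat.cast_mul,
        show (2 * k + 1) * (2 * l + 1) = 2 * (2 * k * l + k + l) + 1 by ring, he]) i.2 j.2
  have hef : ∀ i j : Fin N, e i * f j = if i = j then f j else 0 := fun i j => by
    simpa [Fin.ext_iff] using component_mul_component ho hv he hf (g := f) (fun k l => by
      rw [shuffleSum_mul, ← Nat.cast_mul,
        show (2 * k + 1) * (2 * l + 2) = 2 * (2 * k * l + 2 * k + l) + 2 by ring, hf]) i.2 j.2
  have hfe : ∀ i j : Fin N, f i * e j = if i = j then f j else 0 := fun i j => by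
    simpa [Fin.ext_iff] using component_mul_component hv ho hf he (g := f) (fun k l => by
      rw [shuffleSum_mul, ← Nat.cast_mul,
        show (2 * k + 2) * (2 * l + 1) = 2 * (2 * k * l + k + 2 * l) + 2 by ring, hf]) i.2 j.2
  have hff : ∀ i j : Fin N, f i * f j = if i = j then f j else 0 := fun i j => by
    simpa [Fin.ext_iff] using component_mul_component hv hv hf hf (g := f) (fun k l => by
      rw [shuffleSum_mul, ← Nat.cast_mul,
        show (2 * k + 2) * (2 * l + 2) = 2 * (2 * k * l + 2 * k + 2 * l + 1) + 2 by ring, hf])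
        i.2 j.2
  -- Since e_i f_i = f_i e_i = f_i, subtracting f_i from e_i makes the two families orthogonal.
  let F : Fin N ⊕ Fin N → PermAlg (m + 1) :=
    Sum.elim (fun i => e i - f i) fun i => f i
  have hF : ∀ a b, F a * F b = if a = b then F b else 0 := by
    rintro (i | i) (j | j) <;>
      simp only [F, Sum.elim_inl, Sum.elim_inr, sub_mul, mul_sub, hee, hef, hfe, hff,
        Sum.inl.injEq, Sum.inr.injEq, reduceCtorEq] <;>
      split_ifs <;> simp_all
  have hfF : ∀ i < N, f i ∈ Submodule.span ℚ (Set.range F) := fun i hi =>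
    Submodule.subset_span ⟨Sum.inr ⟨i, hi⟩, rfl⟩
  have heF : ∀ i < N, e i ∈ Submodule.span ℚ (Set.range F) := fun i hi => by
    have : e i - f i ∈ Submodule.span ℚ (Set.range F) :=
      Submodule.subset_span ⟨Sum.inl ⟨i, hi⟩, rfl⟩
    simpa using Submodule.add_mem _ this (hfF i hi)
  suffices H : fullPeakCountSpan (m + 1) ≤ Submodule.span ℚ (Set.range F) from
    eq_zero_of_mul_self_eq_zero_of_mem_span hF (H hx) h
  rw [fullPeakCountSpan, peakCountSpan_eq_span_shuffleSum, intPeakCountSpan_eq_span_shuffleSum]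
  refine sup_le (Submodule.span_le.2 ?_) (Submodule.span_le.2 ?_)
  · rintro _ ⟨k, rfl⟩
    simp only [he]
    exact Submodule.sum_mem _ fun i hi => Submodule.smul_mem _ _ (heF i (Finset.mem_range.1 hi))
  · rintro _ ⟨k, rfl⟩
    simp only [hf]
    exact Submodule.sum_mem _ fun i hi => Submodule.smul_mem _ _ (hfF i (Finset.mem_range.1 hi))

theorem shuffleSum_pow (n x k : ℕ) : shuffleSum n x ^ k = shuffleSum n (x ^ k) := by
  induction k with
  | zero => rw [pow_zero, pow_zero, shuffleSum_one]
  | succ k ih => rw [pow_succ, pow_succ, ih, shuffleSum_mul]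

/-- The powers 3^k are infinitely many odd nodes, so the powers of Σ_3 already determine all
components e_i. -/
theorem shuffleSum_odd_mem_of_shuffleSum_three_mem {m : ℕ} (S : Subalgebra ℚ (PermAlg (m + 1)))
    (h : shuffleSum (m + 1) 3 ∈ S) (k : ℕ) : shuffleSum (m + 1) (2 * k + 1) ∈ S := by
  obtain ⟨N, e, -, he, -⟩ := exists_shuffleSum_components m
  have ht : Function.Injective fun k : ℕ => ((3 ^ k : ℕ) : ℚ) :=
    Nat.cast_injective.comp (Nat.pow_right_injective (by norm_num))
  have hmem : ∀ i < N, e i ∈ Subalgebra.toSubmodule S := fun i hi =>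
    mem_of_forall_sum_pow_smul_mem _ e ht (fun k => by
      obtain ⟨l, hl⟩ : Odd (3 ^ k) := Odd.pow (by decide)
      have : shuffleSum (m + 1) (3 ^ k) ∈ S := shuffleSum_pow (m + 1) 3 k ▸ S.pow_mem h k
      rw [hl, he] at this
      simp only [hl]
      exact this) hi
  rw [he]
  exact S.sum_mem fun i hi => S.smul_mem (hmem i (Finset.mem_range.1 hi)) _

theorem shuffleSum_mem_of_shuffleSum_two_mem {m : ℕ} (S : Subalgebra ℚ (PermAlg (m + 1)))
    (h3 : shuffleSum (m + 1) 3 ∈ S) (h2 : shuffleSum (m + 1) 2 ∈ S) (k : ℕ) :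
    shuffleSum (m + 1) (k + 1) ∈ S := by
  induction k using Nat.strong_induction_on with
  | _ k ih =>
    rcases Nat.even_or_odd' k with ⟨l, rfl | rfl⟩
    · exact shuffleSum_odd_mem_of_shuffleSum_three_mem S h3 l
    · rw [show 2 * l + 1 + 1 = 2 * (l + 1) by ring, ← shuffleSum_mul]
      exact S.mul_mem h2 (ih l (by omega))

theorem peakCountSum_zero (m : ℕ) : peakCountSum (m + 1) 0 = 1 := by
  have h := shuffleSum_odd m 0
  rw [mul_zero, zero_add, shuffleSum_one, Finset.sum_range_one, oddCoeff_self, pow_zero,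
    one_smul] at h
  exact h.symm

theorem shuffleSum_three (m : ℕ) : shuffleSum (m + 1) 3 =
    oddCoeff (m + 1) 1 0 • 1 + (4 : ℚ) • peakCountSum (m + 1) 1 := by
  have h := shuffleSum_odd m 1
  rw [Finset.sum_range_succ, Finset.sum_range_one, oddCoeff_self, pow_one,
    peakCountSum_zero] at h
  exact h

theorem shuffleSum_two (m : ℕ) :
    shuffleSum (m + 1) 2 = (2 : ℚ) • intPeakCountSum (m + 1) 1 := by
  have h := shuffleSum_even m 0
  rw [Finset.sum_range_one, evenCoeff_self, pow_zero, one_mul] at h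
  exact h

theorem shuffleSum_three_mem {m : ℕ} (S : Subalgebra ℚ (PermAlg (m + 1)))
    (h : peakCountSum (m + 1) 1 ∈ S) : shuffleSum (m + 1) 3 ∈ S := by
  rw [shuffleSum_three]
  exact S.add_mem (S.smul_mem S.one_mem _) (S.smul_mem h _)

theorem shuffleSum_two_mem {m : ℕ} (S : Subalgebra ℚ (PermAlg (m + 1)))
    (h : intPeakCountSum (m + 1) 1 ∈ S) : shuffleSum (m + 1) 2 ∈ S := by
  rw [shuffleSum_two]
  exact S.smul_mem h _

theorem one_mem_peakCountSpan (m : ℕ) : 1 ∈ peakCountSpan (m + 1) :=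
  peakCountSum_zero m ▸ peakCountSum_mem m 0

theorem peakCountSpan_le_fullPeakCountSpan (n : ℕ) : peakCountSpan n ≤ fullPeakCountSpan n :=
  le_sup_left

theorem intPeakCountSpan_le_fullPeakCountSpan (n : ℕ) :
    intPeakCountSpan n ≤ fullPeakCountSpan n :=
  le_sup_right

theorem mul_mem_peakCountSpan {m : ℕ} {x y : PermAlg (m + 1)}
    (hx : x ∈ peakCountSpan (m + 1)) (hy : y ∈ peakCountSpan (m + 1)) :
    x * y ∈ peakCountSpan (m + 1) := by
  rw [peakCountSpan_eq_span_shuffleSum] at *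
  refine mul_mem_span_of_forall_mul_mem ?_ hx hy
  rintro _ ⟨k, rfl⟩ _ ⟨l, rfl⟩
  refine ⟨2 * k * l + k + l, ?_⟩
  simp only [shuffleSum_mul]
  congr 1
  ring

theorem mul_mem_fullPeakCountSpan {m : ℕ} {x y : PermAlg (m + 1)}
    (hx : x ∈ fullPeakCountSpan (m + 1)) (hy : y ∈ fullPeakCountSpan (m + 1)) :
    x * y ∈ fullPeakCountSpan (m + 1) := by
  rw [fullPeakCountSpan_eq_span_shuffleSum] at *
  refine mul_mem_span_of_forall_mul_mem ?_ hx hy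
  rintro _ ⟨k, rfl⟩ _ ⟨l, rfl⟩
  refine ⟨k * l + k + l, ?_⟩
  simp only [shuffleSum_mul]
  congr 1
  ring

theorem mul_comm_of_mem_fullPeakCountSpan {m : ℕ} {x y : PermAlg (m + 1)}
    (hx : x ∈ fullPeakCountSpan (m + 1)) (hy : y ∈ fullPeakCountSpan (m + 1)) :
    x * y = y * x := by
  rw [fullPeakCountSpan_eq_span_shuffleSum] at *
  refine mul_comm_of_mem_span ?_ hx hy
  rintro _ ⟨k, rfl⟩ _ ⟨l, rfl⟩
  simp only [shuffleSum_mul, mul_comm]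

theorem mul_mem_intPeakCountSpan {m : ℕ} {x y : PermAlg (m + 1)}
    (hx : x ∈ fullPeakCountSpan (m + 1)) (hy : y ∈ intPeakCountSpan (m + 1)) :
    x * y ∈ intPeakCountSpan (m + 1) := by
  rw [fullPeakCountSpan_eq_span_shuffleSum] at hx
  rw [intPeakCountSpan_eq_span_shuffleSum] at *
  refine mul_mem_span_of_forall_mul_mem ?_ hx hy
  rintro _ ⟨k, rfl⟩ _ ⟨l, rfl⟩
  refine ⟨k * l + k + l, ?_⟩
  simp only [shuffleSum_mul]
  congr 1
  ring

instance (n : ℕ) : Module.Finite ℚ (PermAlg n) :=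
  Module.Finite.equiv (MonoidAlgebra.coeffLinearEquiv ℚ).symm

/-- The span `℘_n` as a subalgebra. -/
noncomputable def peakCountSubalgebra (m : ℕ) : Subalgebra ℚ (PermAlg (m + 1)) :=
  (peakCountSpan (m + 1)).toSubalgebra (one_mem_peakCountSpan m)
    fun _ _ => mul_mem_peakCountSpan

/-- The sum `℘̂_n` as a subalgebra. -/
noncomputable def fullPeakCountSubalgebra (m : ℕ) : Subalgebra ℚ (PermAlg (m + 1)) :=
  (fullPeakCountSpan (m + 1)).toSubalgebra
    (peakCountSpan_le_fullPeakCountSpan _ (one_mem_peakCountSpan m))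
    fun _ _ => mul_mem_fullPeakCountSpan

theorem peakCountSubalgebra_eq_adjoin (m : ℕ) :
    peakCountSubalgebra m = Algebra.adjoin ℚ {peakCountSum (m + 1) 1} := by
  apply le_antisymm
  · have h3 := shuffleSum_three_mem (Algebra.adjoin ℚ {peakCountSum (m + 1) 1})
      (Algebra.subset_adjoin rfl)
    rw [← Subalgebra.toSubmodule.le_iff_le, peakCountSubalgebra,
      Submodule.toSubalgebra_toSubmodule]
    rw [peakCountSpan_eq_span_shuffleSum, Submodule.span_le]
    rintro _ ⟨k, rfl⟩
    exact shuffleSum_odd_mem_of_shuffleSum_three_mem _ h3 k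
  · exact Algebra.adjoin_le (Set.singleton_subset_iff.2 (peakCountSum_mem m 1))

theorem fullPeakCountSubalgebra_eq_adjoin (m : ℕ) : fullPeakCountSubalgebra m =
    Algebra.adjoin ℚ {peakCountSum (m + 1) 1, intPeakCountSum (m + 1) 1} := by
  apply le_antisymm
  · have h3 := shuffleSum_three_mem
      (Algebra.adjoin ℚ {peakCountSum (m + 1) 1, intPeakCountSum (m + 1) 1})
      (Algebra.subset_adjoin (Or.inl rfl))
    have h2 := shuffleSum_two_mem
      (Algebra.adjoin ℚ {peakCountSum (m + 1) 1, intPeakCountSum (m + 1) 1})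
      (Algebra.subset_adjoin (Or.inr rfl))
    rw [← Subalgebra.toSubmodule.le_iff_le, fullPeakCountSubalgebra,
      Submodule.toSubalgebra_toSubmodule]
    rw [fullPeakCountSpan_eq_span_shuffleSum, Submodule.span_le]
    rintro _ ⟨k, rfl⟩
    exact shuffleSum_mem_of_shuffleSum_two_mem _ h3 h2 k
  · refine Algebra.adjoin_le ?_
    rintro _ (rfl | rfl)
    · exact peakCountSpan_le_fullPeakCountSpan _ (peakCountSum_mem m 1)
    · exact intPeakCountSpan_le_fullPeakCountSpan _ (intPeakCountSum_mem m 0)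

theorem mem_twoSidedIdeal_span_intPeakCountSum_iff (m : ℕ)
    (h : intPeakCountSum (m + 1) 1 ∈ fullPeakCountSubalgebra m)
    (x : fullPeakCountSubalgebra m) :
    x ∈ TwoSidedIdeal.span {(⟨intPeakCountSum (m + 1) 1, h⟩ : fullPeakCountSubalgebra m)} ↔
      (x : PermAlg (m + 1)) ∈ intPeakCountSpan (m + 1) := by
  set c : fullPeakCountSubalgebra m := ⟨intPeakCountSum (m + 1) 1, h⟩
  constructor
  · intro hx
    let I : TwoSidedIdeal (fullPeakCountSubalgebra m) :=
      TwoSidedIdeal.mk' {y | (y : PermAlg (m + 1)) ∈ intPeakCountSpan (m + 1)}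
        (intPeakCountSpan (m + 1)).zero_mem (fun hx hy => (intPeakCountSpan (m + 1)).add_mem hx hy)
        (fun hx => (intPeakCountSpan (m + 1)).neg_mem hx)
        (fun {x _} hy => mul_mem_intPeakCountSpan x.2 hy)
        (fun {x y} hx => by
          change (x : PermAlg (m + 1)) * y ∈ intPeakCountSpan (m + 1)
          rw [mul_comm_of_mem_fullPeakCountSpan x.2 y.2]
          exact mul_mem_intPeakCountSpan y.2 hx)
    have hI : ∀ y : fullPeakCountSubalgebra m,
        y ∈ I ↔ (y : PermAlg (m + 1)) ∈ intPeakCountSpan (m + 1) := fun y =>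
      TwoSidedIdeal.mem_mk' {y : fullPeakCountSubalgebra m |
        (y : PermAlg (m + 1)) ∈ intPeakCountSpan (m + 1)} _ _ _ _ _ y
    exact (hI x).1 (TwoSidedIdeal.mem_span_iff.1 hx I
      (Set.singleton_subset_iff.2 ((hI c).2 (intPeakCountSum_mem m 0))))
  · intro hx
    -- The ideal turns out to be the set of multiples of the generator.
    suffices H : ∀ y ∈ intPeakCountSpan (m + 1), ∃ z : fullPeakCountSubalgebra m,
        intPeakCountSum (m + 1) 1 * (z : PermAlg (m + 1)) = y by
      obtain ⟨z, hz⟩ := H x hx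
      have : x = c * z := Subtype.ext hz.symm
      rw [this]
      exact TwoSidedIdeal.mul_mem_right _ _ _ (TwoSidedIdeal.subset_span rfl)
    intro y hy
    rw [intPeakCountSpan_eq_span_shuffleSum] at hy
    induction hy using Submodule.span_induction with
    | mem y hy =>
      obtain ⟨k, rfl⟩ := hy
      have hk : shuffleSum (m + 1) (k + 1) ∈ fullPeakCountSpan (m + 1) := by
        rw [fullPeakCountSpan_eq_span_shuffleSum]
        exact Submodule.subset_span ⟨k, rfl⟩
      -- Σ_{2k+2} = Σ_2 Σ_{k+1} and Σ_2 = 2p°_1; the 2 is moved into the cofactor.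
      refine ⟨⟨(2 : ℚ) • shuffleSum (m + 1) (k + 1), Submodule.smul_mem _ _ hk⟩, ?_⟩
      simp only
      rw [mul_smul_comm, ← smul_mul_assoc, ← shuffleSum_two, shuffleSum_mul]
      congr 1
    | zero => exact ⟨0, mul_zero _⟩
    | add y y' _ _ h1 h2 =>
      obtain ⟨z, rfl⟩ := h1
      obtain ⟨z', rfl⟩ := h2
      exact ⟨z + z', mul_add _ _ _⟩
    | smul a y _ h1 =>
      obtain ⟨z, rfl⟩ := h1
      exact ⟨a • z, mul_smul_comm _ _ _⟩

end AlgebraStructure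

theorem mainTheorem6 (n : ℕ) (hn : 1 ≤ n) :
    ∃ A B : Subalgebra ℚ (PermAlg n),
      -- the two spans are subalgebras, the larger one inside the peak algebra
      Subalgebra.toSubmodule A = fullPeakCountSpan n ∧
      Subalgebra.toSubmodule B = peakCountSpan n ∧
      Subalgebra.toSubmodule A ≤ peakAlgebra n ∧
      B ≤ A ∧
      -- commutativity and semisimplicity
      (∀ x ∈ A, ∀ y ∈ A, x * y = y * x) ∧
      IsSemisimpleRing A ∧
      IsSemisimpleRing B ∧
      -- generators
      A = Algebra.adjoin ℚ {peakCountSum n 1, intPeakCountSum n 1} ∧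
      B = Algebra.adjoin ℚ {peakCountSum n 1} ∧
      (∃ h : intPeakCountSum n 1 ∈ A, ∀ x : A,
        x ∈ TwoSidedIdeal.span {(⟨intPeakCountSum n 1, h⟩ : A)} ↔
          (x : PermAlg n) ∈ intPeakCountSpan n) ∧
      -- dimensions
      Module.finrank ℚ (fullPeakCountSpan n) = n ∧
      Module.finrank ℚ (peakCountSpan n) = n / 2 + 1 ∧
      Module.finrank ℚ (intPeakCountSpan n) = (n + 1) / 2 := by
  obtain ⟨m, rfl⟩ := Nat.exists_eq_add_of_le' hn
  have hle : peakCountSubalgebra m ≤ fullPeakCountSubalgebra m :=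
    fun x hx => peakCountSpan_le_fullPeakCountSpan _ hx
  have hcomm : ∀ x ∈ fullPeakCountSubalgebra m, ∀ y ∈ fullPeakCountSubalgebra m,
      x * y = y * x := fun x hx y hy => mul_comm_of_mem_fullPeakCountSpan hx hy
  refine ⟨fullPeakCountSubalgebra m, peakCountSubalgebra m, rfl, rfl,
    fullPeakCountSpan_le_peakAlgebra (m + 1), hle, hcomm,
    Subalgebra.isSemisimpleRing_of_comm_of_reduced _ hcomm
      fun x hx => eq_zero_of_mul_self_of_mem_fullPeakCountSpan hx,
    Subalgebra.isSemisimpleRing_of_comm_of_reduced _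
      (fun x hx y hy => hcomm x (hle hx) y (hle hy))
      fun x hx => eq_zero_of_mul_self_of_mem_fullPeakCountSpan (hle hx),
    fullPeakCountSubalgebra_eq_adjoin m, peakCountSubalgebra_eq_adjoin m,
    ⟨intPeakCountSpan_le_fullPeakCountSpan _ (intPeakCountSum_mem m 0),
      mem_twoSidedIdeal_span_intPeakCountSum_iff m _⟩,
    finrank_fullPeakCountSpan m, finrank_peakCountSpan m, finrank_intPeakCountSpan m⟩
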